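/- For a real number $\alpha>0$ let $k=\lceil\alpha\rceil$. A function $f:\mathbb R\to\mathbb R$ is of class $C^{1+\alpha}$ if it is $k$ times continuously differentiable and its $k$-th derivative is locally Hölder of exponent $1+\alpha-k\in(0,1]$, i.e. satisfies a Hölder estimate on every compact interval, with a constant that may depend on $f$ and on the interval. (For $0<\alpha\le 1$: $f$ is $C^1$ and $f'$ is locally $\alpha$-Hölder.) Let $\mathrm{Homeo}_+(\mathbb R)$ be the group of orientation-preserving homeomorphisms of $\mathbb R$. Theorem 1.4. Let $\alpha>0$ and let $G$ be a nilpotent subgroup of $\mathrm{Homeo}_+(\mathbb R)$, all of whose elements are of class $C^{1+\alpha}$ ($G$ is not assumed to be finitely generated or countable). Then (1) there is a $G$-invariant Radon measure on $\mathbb R$, i.e. a nonzero Borel measure $\mu$ on $\mathbb R$, finite on every compact set, with $g_*\mu=\mu$ for all $g\in G$; and (2) there is a minimal closed invariant set, i.e. a nonempty closed set $K\subseteq\mathbb R$ with $g(K)=K$ for all $g\in G$ that is minimal with respect to inclusion among all nonempty closed $G$-invariant subsets of $\mathbb R$. -/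

import Mathlib

open MeasureTheory

/-- `Homeo₊(ℝ)`: the group of orientation-preserving (that is, strictly increasing)
homeomorphisms of the real line, as a subgroup of the group of all homeomorphisms. -/
def homeoPlus : Subgroup (ℝ ≃ₜ ℝ) where
  carrier := {f | StrictMono f}
  mul_mem' := fun {_ _} hf hg _ _ hxy => hf (hg hxy)
  one_mem' := strictMono_id
  inv_mem' := fun {f} hf x y hxy => by
    have h : f (f.symm x) < f (f.symm y) := by simpa using hxy
    exact hf.lt_iff_lt.mp h

/-- `g` is locally Hölder continuous of exponent `β`: it satisfies a Hölder estimate on every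
compact interval, with a constant that may depend on the interval. -/
def IsLocallyHolder (β : ℝ) (g : ℝ → ℝ) : Prop :=
  ∀ a b : ℝ, ∃ C : ℝ, ∀ x ∈ Set.Icc a b, ∀ y ∈ Set.Icc a b, |g x - g y| ≤ C * |x - y| ^ β

/-- `f` is of class `C^{1+α}` (for `α > 0`). Let `k = ⌈α⌉`, so that `k` is the largest integer
strictly below `1 + α`; then `f` is `k` times continuously differentiable and its `k`-th
derivative is locally Hölder of exponent `1 + α - k ∈ (0, 1]`. In the main range `0 < α ≤ 1`
this says that `f` is `C¹` and `f'` is locally `α`-Hölder. -/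
def IsC1plus (α : ℝ) (f : ℝ → ℝ) : Prop :=
  ContDiff ℝ (⌈α⌉₊ : ℕ) f ∧ IsLocallyHolder (1 + α - (⌈α⌉₊ : ℝ)) (iteratedDeriv ⌈α⌉₊ f)

/-- `μ` is a `G`-invariant Radon measure on `ℝ`: a nonzero Borel measure, finite on compact sets,
which every element of `G` preserves. -/
def IsInvariantRadon (G : Subgroup (ℝ ≃ₜ ℝ)) (μ : Measure ℝ) : Prop :=
  μ ≠ 0 ∧ IsFiniteMeasureOnCompacts μ ∧ ∀ g ∈ G, μ.map (g : ℝ → ℝ) = μ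

/-- `K` is a nonempty closed subset of `ℝ` invariant under `G`. -/
def IsClosedInvariant (G : Subgroup (ℝ ≃ₜ ℝ)) (K : Set ℝ) : Prop :=
  K.Nonempty ∧ IsClosed K ∧ ∀ g ∈ G, (g : ℝ → ℝ) '' K = K

/-- `K` is a minimal closed invariant set of `G`: it is minimal for inclusion among the nonempty
closed `G`-invariant subsets of `ℝ`. -/
def IsMinimalClosedInvariant (G : Subgroup (ℝ ≃ₜ ℝ)) (K : Set ℝ) : Prop :=
  Minimal (IsClosedInvariant G) K

/-!
If `G` has a global fixed point `x`, the set `{x}` and the Dirac mass at `x` answer the question.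
Otherwise everything follows from an element `f ∈ G` without fixed points: every closed invariant
set meets the compact interval `[0, f 0]`, and translation numbers can be measured against `f`.

*The fixed point free element.* Let `A` be the last term of the lower central series without a
global fixed point and `F` the set of common fixed points of `⁅A, G⁆`. The elements of `A` commute
with each other on `F` (`exists_actsCommutativelyOn`), though not elsewhere. If each of them had a
fixed point in `F`, there would be an infinite tower of nested bounded intervals with endpoints
in `F`, each of them preserved by some element `a j` of `A` that moves the previous one off itself
(`ActsCommutativelyOn.exists_tower`). The images of the smallest interval under the products
`a_e ^ n_e ⋯ a_0 ^ n_0` are then disjoint, of finite total length. Pólya's urn on `ℕ ^ (e + 1)`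
visits each point of the level `k` with probability of order `k ^ (-e)`. Since `e` is arbitrary, it
can be taken so large that, on average, and so for at least one path of any given length, the sum
of the `β`-th powers of the lengths met along the path is bounded (`exists_minCost_le`). The
corresponding compositions thus have uniformly bounded distortion. By an argument in the style of
Kopell's lemma, no element of `A` preserving the smallest interval can then move a point of `F`
inside it (`IsTower.false_of_moved`), contrary to the choice of that interval. This is the only use of the
regularity of `G`, and what replaces finite generation.

*The minimal set and the measure.* Zorn's lemma gives a minimal set `K`. An element commuting with
`G` on `K` acts on `K` trivially or freely; a commutator `⁅h, g⁆` acting in this second way cannot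
exist, because `hⁿ gⁿ` would differ from `gⁿ hⁿ` by a quadratic displacement. Going down the lower
central series, `G` acts on `K` through an abelian quotient (`IsMinimalClosedInvariant.comm`). The
translation numbers `τ` with respect to `f` along the orbit of a point `x₀ ∈ K` then form a
homomorphism, and `φ y = inf {τ g | y < g x₀}` is a right continuous monotone function with
`φ (h y) = φ y + τ h`, whose Stieltjes measure is invariant.
-/

open scoped commutatorElement

/-! ### Commutative actions on a closed set and their blocks -/

lemma inv_apply_apply (g : ℝ ≃ₜ ℝ) (x : ℝ) : g⁻¹ (g x) = x := g.symm_apply_apply x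

lemma apply_inv_apply (g : ℝ ≃ₜ ℝ) (x : ℝ) : g (g⁻¹ x) = x := g.apply_symm_apply x

lemma homeoPlus_strictMono {f : ℝ ≃ₜ ℝ} (hf : f ∈ homeoPlus) : StrictMono f := hf

lemma map_sSup_eq_of_invariant {A : Subgroup (ℝ ≃ₜ ℝ)} (hA : A ≤ homeoPlus) {S : Set ℝ}
    (hne : S.Nonempty) (hb : BddAbove S) (hS : ∀ a ∈ A, ∀ x ∈ S, a x ∈ S) :
    ∀ a ∈ A, a (sSup S) = sSup S := by
  have key : ∀ a ∈ A, sSup S ≤ a (sSup S) := fun a ha => csSup_le hne fun x hx => by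
    have h1 := (homeoPlus_strictMono (hA ha)).monotone
      (le_csSup hb (hS _ (A.inv_mem ha) x hx))
    rwa [apply_inv_apply] at h1
  refine fun a ha => le_antisymm ?_ (key a ha)
  have h1 := (homeoPlus_strictMono (hA ha)).monotone (key _ (A.inv_mem ha))
  rwa [apply_inv_apply] at h1

lemma map_sInf_eq_of_invariant {A : Subgroup (ℝ ≃ₜ ℝ)} (hA : A ≤ homeoPlus) {S : Set ℝ}
    (hne : S.Nonempty) (hb : BddBelow S) (hS : ∀ a ∈ A, ∀ x ∈ S, a x ∈ S) :
    ∀ a ∈ A, a (sInf S) = sInf S := by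
  have key : ∀ a ∈ A, a (sInf S) ≤ sInf S := fun a ha => le_csInf hne fun x hx => by
    have h1 := (homeoPlus_strictMono (hA ha)).monotone
      (csInf_le hb (hS _ (A.inv_mem ha) x hx))
    rwa [apply_inv_apply] at h1
  refine fun a ha => le_antisymm (key a ha) ?_
  have h1 := (homeoPlus_strictMono (hA ha)).monotone (key _ (A.inv_mem ha))
  rwa [apply_inv_apply] at h1

/-- The group `A` acts on the closed set `F` by increasing maps that commute with each other
*on `F`*, and it fixes no point of `F`. Away from `F` the elements of `A` need not commute. -/
structure ActsCommutativelyOn (A : Subgroup (ℝ ≃ₜ ℝ)) (F : Set ℝ) : Prop where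
  le_homeoPlus : A ≤ homeoPlus
  isClosed : IsClosed F
  mapsTo : ∀ a ∈ A, ∀ x ∈ F, a x ∈ F
  comm : ∀ a ∈ A, ∀ b ∈ A, ∀ x ∈ F, a (b x) = b (a x)
  exists_moved : ∀ x ∈ F, ∃ a ∈ A, a x ≠ x

/-- The interval `(p, q)` with endpoints in `F` is a block: each element of `A` either preserves it
or moves it off itself. -/
structure IsBlock (A : Subgroup (ℝ ≃ₜ ℝ)) (F : Set ℝ) (p q : ℝ) : Prop where
  left_mem : p ∈ F
  right_mem : q ∈ F
  lt : p < q
  trichotomy : ∀ g ∈ A, g q ≤ p ∨ (g p = p ∧ g q = q) ∨ q ≤ g p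

lemma IsBlock.fixed {A : Subgroup (ℝ ≃ₜ ℝ)} (hA : A ≤ homeoPlus) {F : Set ℝ} {p q : ℝ}
    (h : IsBlock A F p q) {g : ℝ ≃ₜ ℝ} (hg : g ∈ A) {y : ℝ} (hy : g y = y) (hpy : p < y)
    (hyq : y < q) : g p = p ∧ g q = q := by
  have hm := homeoPlus_strictMono (hA hg)
  have h1 := hm hpy
  have h2 := hm hyq
  rcases h.trichotomy g hg with h | h | h
  · linarith
  · exact h
  · linarith

namespace ActsCommutativelyOn

variable {A : Subgroup (ℝ ≃ₜ ℝ)} {F : Set ℝ} (h : ActsCommutativelyOn A F)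

include h

lemma strictMono {a : ℝ ≃ₜ ℝ} (ha : a ∈ A) : StrictMono a := h.le_homeoPlus ha

/-- Around a point of `F` moved by `a`, the fixed points of `a` in `F` bound a block. The set of
fixed points of `a` in `F` is `A`-invariant by commutation, hence unbounded in both directions. -/
lemma exists_block {a : ℝ ≃ₜ ℝ} (ha : a ∈ A) {z x : ℝ} (hz : z ∈ F) (haz : a z = z)
    (hax : a x ≠ x) : ∃ p q, IsBlock A F p q ∧ p < x ∧ x < q ∧ a p = p ∧ a q = q := by
  set S : Set ℝ := {y | y ∈ F ∧ a y = y} with hSdef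
  have hSc : IsClosed S := h.isClosed.inter (isClosed_eq a.continuous continuous_id)
  have hSinv : ∀ g ∈ A, ∀ y ∈ S, g y ∈ S := fun g hg y hy =>
    ⟨h.mapsTo g hg y hy.1, by rw [h.comm a ha g hg y hy.1, hy.2]⟩
  have hSne : S.Nonempty := ⟨z, hz, haz⟩
  have hnb : ¬ BddAbove S := fun hb => by
    obtain ⟨g, hg, hgx⟩ := h.exists_moved _ (hSc.csSup_mem hSne hb).1
    exact hgx (map_sSup_eq_of_invariant h.le_homeoPlus hSne hb hSinv g hg)
  have hnb' : ¬ BddBelow S := fun hb => by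
    obtain ⟨g, hg, hgx⟩ := h.exists_moved _ (hSc.csInf_mem hSne hb).1
    exact hgx (map_sInf_eq_of_invariant h.le_homeoPlus hSne hb hSinv g hg)
  rw [not_bddAbove_iff] at hnb
  rw [not_bddBelow_iff] at hnb'
  obtain ⟨r, hr, hxr⟩ := hnb x
  obtain ⟨l, hl, hlx⟩ := hnb' x
  have hLne : (S ∩ Set.Iic x).Nonempty := ⟨l, hl, hlx.le⟩
  have hLb : BddAbove (S ∩ Set.Iic x) := ⟨x, fun y hy => hy.2⟩
  have hRne : (S ∩ Set.Ici x).Nonempty := ⟨r, hr, hxr.le⟩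
  have hRb : BddBelow (S ∩ Set.Ici x) := ⟨x, fun y hy => hy.2⟩
  obtain ⟨hpS, hpx⟩ := (hSc.inter isClosed_Iic).csSup_mem hLne hLb
  obtain ⟨hqS, hqx⟩ := (hSc.inter isClosed_Ici).csInf_mem hRne hRb
  have hpmax : ∀ y ∈ S, y ≤ x → y ≤ sSup (S ∩ Set.Iic x) := fun y hy hyx =>
    le_csSup hLb ⟨hy, hyx⟩
  have hqmin : ∀ y ∈ S, x ≤ y → sInf (S ∩ Set.Ici x) ≤ y := fun y hy hyx =>
    csInf_le hRb ⟨hy, hyx⟩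
  generalize sSup (S ∩ Set.Iic x) = p at *
  generalize sInf (S ∩ Set.Ici x) = q at *
  have hpx' : p < x := lt_of_le_of_ne hpx fun e => hax (e ▸ hpS.2)
  have hqx' : x < q := lt_of_le_of_ne hqx fun e => hax (e ▸ hqS.2)
  have hgap : ∀ y ∈ S, y ≤ p ∨ q ≤ y := fun y hy =>
    (le_total y x).imp (hpmax y hy) (hqmin y hy)
  have hpq : p < q := hpx'.trans hqx'
  refine ⟨p, q, ⟨hpS.1, hqS.1, hpq, fun g hg => ?_⟩, hpx', hqx', hpS.2, hqS.2⟩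
  have hm := h.strictMono hg
  have hg' := A.inv_mem hg
  have hcan : ∀ y, g (g⁻¹ y) = y := fun y => apply_inv_apply g y
  rcases hgap _ (hSinv g hg q hqS) with h1 | h1
  · exact Or.inl h1
  rcases hgap _ (hSinv g hg p hpS) with h2 | h2
  · refine Or.inr (Or.inl ?_)
    rcases hgap _ (hSinv _ hg' p hpS) with h3 | h3
    · rcases hgap _ (hSinv _ hg' q hqS) with h4 | h4
      · have := hm.monotone h4
        rw [hcan] at this
        linarith
      · have h5 := hm.monotone h3
        have h6 := hm.monotone h4
        rw [hcan] at h5 h6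
        exact ⟨le_antisymm h2 h5, le_antisymm h6 h1⟩
    · have := hm.monotone h3
      rw [hcan] at this
      linarith
  · exact Or.inr (Or.inr h2)

/-- If every element of `A` has a fixed point in `F`, each block lies in a larger one, within which
some element `a` moves it to the right, off itself. -/
lemma exists_larger_block (hfix : ∀ a ∈ A, ∃ z ∈ F, a z = z) {p q : ℝ} (hb : IsBlock A F p q) :
    ∃ a ∈ A, ∃ p' q', IsBlock A F p' q' ∧ a p' = p' ∧ a q' = q' ∧ p' < p ∧ q < q' ∧ q ≤ a p := by
  obtain ⟨a, ha, hap, hap'⟩ : ∃ a ∈ A, a p ≠ p ∧ q ≤ a p := by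
    obtain ⟨a, ha, hap⟩ := h.exists_moved p hb.left_mem
    rcases hb.trichotomy a ha with h1 | h1 | h1
    · have h2 := (h.strictMono (A.inv_mem ha)).monotone h1
      rw [inv_apply_apply] at h2
      exact ⟨a⁻¹, A.inv_mem ha, (hb.lt.trans_le h2).ne', h2⟩
    · exact absurd h1.1 hap
    · exact ⟨a, ha, hap, h1⟩
  obtain ⟨z, hz, haz⟩ := hfix a ha
  obtain ⟨p', q', hb', hp, hq, hp', hq'⟩ := h.exists_block ha hz haz hap
  refine ⟨a, ha, p', q', hb', hp', hq', hp, ?_, hap'⟩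
  have := h.strictMono ha hq
  linarith

end ActsCommutativelyOn

/-! ### Towers of blocks -/

/-- A tower: an increasing sequence of blocks `(p j, q j)` and elements `a j` of `A`
such that `a j` preserves the block `j + 1` and moves the block `j` to the right, off itself. -/
structure IsTower (A : Subgroup (ℝ ≃ₜ ℝ)) (F : Set ℝ) (a : ℕ → ℝ ≃ₜ ℝ) (p q : ℕ → ℝ) : Prop where
  mem : ∀ j, a j ∈ A
  block : ∀ j, IsBlock A F (p j) (q j)
  left_lt : ∀ j, p (j + 1) < p j
  lt_right : ∀ j, q j < q (j + 1)
  fixed : ∀ j, a j (p (j + 1)) = p (j + 1) ∧ a j (q (j + 1)) = q (j + 1)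
  moved : ∀ j, q j ≤ a j (p j)

lemma ActsCommutativelyOn.exists_tower {A : Subgroup (ℝ ≃ₜ ℝ)} {F : Set ℝ}
    (h : ActsCommutativelyOn A F) (hfix : ∀ a ∈ A, ∃ z ∈ F, a z = z) {p₀ q₀ : ℝ}
    (hb : IsBlock A F p₀ q₀) :
    ∃ (a : ℕ → ℝ ≃ₜ ℝ) (p q : ℕ → ℝ), IsTower A F a p q ∧ p 0 = p₀ ∧ q 0 = q₀ := by
  choose a ha p q hb' hp hq hpp hqq hm using
    fun b : {b : ℝ × ℝ // IsBlock A F b.1 b.2} => h.exists_larger_block hfix b.2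
  let B : ℕ → {b : ℝ × ℝ // IsBlock A F b.1 b.2} := fun n =>
    Nat.rec ⟨(p₀, q₀), hb⟩ (fun _ b => ⟨(p b, q b), hb' b⟩) n
  exact ⟨fun n => a (B n), fun n => (B n).1.1, fun n => (B n).1.2,
    ⟨fun n => ha _, fun n => (B n).2, fun n => hpp _, fun n => hqq _, fun n => ⟨hp _, hq _⟩,
      fun n => hm _⟩, rfl, rfl⟩

/-- The composition `a (d - 1) ^ n (d - 1) ∘ ⋯ ∘ a 0 ^ n 0`. -/
def word (a : ℕ → ℝ ≃ₜ ℝ) (n : ℕ → ℕ) : ℕ → ℝ ≃ₜ ℝ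
  | 0 => 1
  | d + 1 => a d ^ n d * word a n d

lemma word_congr (a : ℕ → ℝ ≃ₜ ℝ) {n m : ℕ → ℕ} {d : ℕ} (h : ∀ i < d, n i = m i) :
    word a n d = word a m d := by
  induction d with
  | zero => rfl
  | succ d ih => rw [word, word, ih fun i hi => h i (by omega), h d (by omega)]

lemma word_mem {A : Subgroup (ℝ ≃ₜ ℝ)} {a : ℕ → ℝ ≃ₜ ℝ} (ha : ∀ j, a j ∈ A) (n : ℕ → ℕ) (d : ℕ) :
    word a n d ∈ A := by
  induction d with
  | zero => exact A.one_mem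
  | succ d ih => exact A.mul_mem (A.pow_mem (ha d) _) ih

lemma word_update {A : Subgroup (ℝ ≃ₜ ℝ)} {F : Set ℝ} (h : ActsCommutativelyOn A F)
    {a : ℕ → ℝ ≃ₜ ℝ} (ha : ∀ j, a j ∈ A) (n : ℕ → ℕ) {d i : ℕ} (hi : i < d) {y : ℝ} (hy : y ∈ F) :
    word a (Function.update n i (n i + 1)) d y = a i (word a n d y) := by
  induction d with
  | zero => omega
  | succ d ih =>
    rcases Nat.lt_succ_iff_lt_or_eq.mp hi with hid | rfl
    · rw [word, word, Homeomorph.mul_apply, Homeomorph.mul_apply, ih hid,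
        Function.update_of_ne hid.ne', h.comm _ (ha i) _ (A.pow_mem (ha d) _)]
      exact h.mapsTo _ (word_mem ha n d) y hy
    · rw [word, word, Function.update_self, word_congr a (m := n) fun j hj =>
        Function.update_of_ne hj.ne _ _, pow_succ', mul_assoc, Homeomorph.mul_apply]

namespace IsTower

variable {A : Subgroup (ℝ ≃ₜ ℝ)} {F : Set ℝ} {a : ℕ → ℝ ≃ₜ ℝ} {p q : ℕ → ℝ}

lemma pow_fixed (T : IsTower A F a p q) (j k : ℕ) :
    (a j ^ k) (p (j + 1)) = p (j + 1) ∧ (a j ^ k) (q (j + 1)) = q (j + 1) := by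
  induction k with
  | zero => exact ⟨rfl, rfl⟩
  | succ k ih =>
    rw [pow_succ, Homeomorph.mul_apply, Homeomorph.mul_apply, (T.fixed j).1, (T.fixed j).2]
    exact ih

lemma pow_right_le_pow_left (T : IsTower A F a p q) (hA : A ≤ homeoPlus) (j : ℕ) {k l : ℕ}
    (hkl : k < l) : (a j ^ k) (q j) ≤ (a j ^ l) (p j) := by
  induction l, hkl using Nat.le_induction with
  | base =>
    rw [pow_succ, Homeomorph.mul_apply]
    exact (homeoPlus_strictMono (hA (A.pow_mem (T.mem j) k))).monotone (T.moved j)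
  | succ l _ ih =>
    refine ih.trans ?_
    rw [pow_succ, Homeomorph.mul_apply]
    exact (homeoPlus_strictMono (hA (A.pow_mem (T.mem j) l))).monotone
      ((T.block j).lt.le.trans (T.moved j))

lemma word_bounds (T : IsTower A F a p q) (hA : A ≤ homeoPlus) (n : ℕ → ℕ) (d : ℕ) :
    p d ≤ word a n d (p 0) ∧ word a n d (q 0) ≤ q d := by
  induction d with
  | zero => exact ⟨le_rfl, le_rfl⟩
  | succ d ih =>
    have hm := (homeoPlus_strictMono (hA (A.pow_mem (T.mem d) (n d)))).monotone
    have h1 := T.pow_fixed d (n d)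
    rw [word, Homeomorph.mul_apply, Homeomorph.mul_apply]
    constructor
    · conv_lhs => rw [← h1.1]
      exact hm ((T.left_lt d).le.trans ih.1)
    · conv_rhs => rw [← h1.2]
      exact hm (ih.2.trans (T.lt_right d).le)

/-- Distinct multi-indices give disjoint images of the block `0`. -/
lemma word_disjoint (T : IsTower A F a p q) (hA : A ≤ homeoPlus) {n m : ℕ → ℕ} {d : ℕ}
    (hnm : ∃ i < d, n i ≠ m i) :
    word a n d (q 0) ≤ word a m d (p 0) ∨ word a m d (q 0) ≤ word a n d (p 0) := by
  induction d with
  | zero => obtain ⟨i, hi, _⟩ := hnm; omega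
  | succ d ih =>
    have key : ∀ n m : ℕ → ℕ, n d < m d → word a n (d + 1) (q 0) ≤ word a m (d + 1) (p 0) := by
      intro n m hlt
      simp only [word, Homeomorph.mul_apply]
      calc _ ≤ (a d ^ n d) (q d) :=
            (homeoPlus_strictMono (hA (A.pow_mem (T.mem d) _))).monotone (T.word_bounds hA n d).2
        _ ≤ (a d ^ m d) (p d) := T.pow_right_le_pow_left hA d hlt
        _ ≤ _ := (homeoPlus_strictMono (hA (A.pow_mem (T.mem d) _))).monotone
            (T.word_bounds hA m d).1
    rcases lt_trichotomy (n d) (m d) with h1 | h1 | h1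
    · exact Or.inl (key n m h1)
    · obtain ⟨i, hi, hne⟩ := hnm
      have hid : i < d := lt_of_le_of_ne (by omega) fun e => hne (e ▸ h1)
      have hm := (homeoPlus_strictMono (hA (A.pow_mem (T.mem d) (n d)))).monotone
      simp only [word, Homeomorph.mul_apply, ← h1]
      exact (ih ⟨i, hid, hne⟩).imp (fun h => hm h) (fun h => hm h)
    · exact Or.inr (key m n h1)

end IsTower

/-- Finitely many disjoint intervals inside `[l, r]` have total length at most `r - l`. -/
lemma sum_length_le_of_disjoint {ι : Type*} (T : Finset ι) (x y : ι → ℝ) {l r : ℝ} (hlr : l ≤ r)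
    (hxy : ∀ i ∈ T, x i ≤ y i) (hl : ∀ i ∈ T, l ≤ x i) (hr : ∀ i ∈ T, y i ≤ r)
    (hd : ∀ i ∈ T, ∀ j ∈ T, i ≠ j → y i ≤ x j ∨ y j ≤ x i) :
    ∑ i ∈ T, (y i - x i) ≤ r - l := by
  have h1 : volume (⋃ i ∈ T, Set.Ioo (x i) (y i)) = ∑ i ∈ T, volume (Set.Ioo (x i) (y i)) := by
    refine measure_biUnion_finset (fun i hi j hj hij => ?_) fun i _ => measurableSet_Ioo
    refine Set.disjoint_left.mpr fun z hz hz' => ?_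
    rcases hd i hi j hj hij with h | h
    · exact absurd (hz.2.trans_le h) hz'.1.not_gt
    · exact absurd (hz'.2.trans_le h) hz.1.not_gt
  have h2 : volume (⋃ i ∈ T, Set.Ioo (x i) (y i)) ≤ volume (Set.Icc l r) :=
    measure_mono (Set.iUnion₂_subset fun i hi z hz =>
      ⟨(hl i hi).trans hz.1.le, hz.2.le.trans (hr i hi)⟩)
  simp only [Real.volume_Ioo, Real.volume_Icc] at h1 h2
  rw [h1, ← ENNReal.ofReal_sum_of_nonneg fun i hi => sub_nonneg.mpr (hxy i hi)] at h2
  exact (ENNReal.ofReal_le_ofReal_iff (sub_nonneg.mpr hlr)).mp h2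

/-- The images of the block `0` under the words with exponents in `T` have bounded total length. -/
lemma IsTower.sum_word_length_le {A : Subgroup (ℝ ≃ₜ ℝ)} {F : Set ℝ} {a : ℕ → ℝ ≃ₜ ℝ}
    {p q : ℕ → ℝ} (T : IsTower A F a p q) (hA : A ≤ homeoPlus) (d : ℕ) (S : Finset (ℕ → ℕ))
    (hS : ∀ n ∈ S, ∀ i, n i ≠ 0 → i < d) :
    ∑ n ∈ S, (word a n d (q 0) - word a n d (p 0)) ≤ q d - p d := by
  refine sum_length_le_of_disjoint S _ _ (T.block d).lt.le
    (fun n _ => (homeoPlus_strictMono (hA (word_mem T.mem n d))).monotone (T.block 0).lt.le)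
    (fun n _ => (T.word_bounds hA n d).1) (fun n _ => (T.word_bounds hA n d).2) ?_
  intro n hn m hm hnm
  obtain ⟨i, hi⟩ := Function.ne_iff.mp hnm
  refine T.word_disjoint hA ⟨i, ?_, hi⟩
  by_contra hid
  have h1 : n i = 0 := by_contra fun h => hid (hS n hn i h)
  have h2 : m i = 0 := by_contra fun h => hid (hS m hm i h)
  exact hi (h1.trans h2.symm)

/-! ### Pólya's urn and cheap paths in a lattice -/

/-- Multi-indices in `ℕ ^ (e + 1)` with sum `k`. -/
def level (e k : ℕ) : Finset (ℕ → ℕ) := Finset.piAntidiag (Finset.range (e + 1)) k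

/-- Increases the `i`-th entry of a multi-index by one. -/
def bump (n : ℕ → ℕ) (i : ℕ) : ℕ → ℕ := Function.update n i (n i + 1)

lemma mem_level {e k : ℕ} {n : ℕ → ℕ} :
    n ∈ level e k ↔ ∑ i ∈ Finset.range (e + 1), n i = k ∧ ∀ i, n i ≠ 0 → i < e + 1 := by
  simp [level]

lemma sum_bump {e i : ℕ} (n : ℕ → ℕ) (hi : i < e + 1) :
    ∑ j ∈ Finset.range (e + 1), bump n i j = ∑ j ∈ Finset.range (e + 1), n j + 1 := by
  have hi' := Finset.mem_range.mpr hi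
  rw [bump, Finset.sum_update_of_mem hi', ← Finset.sum_sdiff (Finset.singleton_subset_iff.mpr hi'),
    Finset.sum_singleton]
  omega

lemma bump_mem_level {e k i : ℕ} {n : ℕ → ℕ} (hn : n ∈ level e k) (hi : i < e + 1) :
    bump n i ∈ level e (k + 1) := by
  rw [mem_level] at hn ⊢
  refine ⟨by rw [sum_bump n hi, hn.1], fun j hj => ?_⟩
  by_cases hji : j = i
  · exact hji ▸ hi
  · exact hn.2 j (by rwa [bump, Function.update_of_ne hji] at hj)

/-- The transition `n → n + eᵢ` with probability proportional to `n i + 1` (Pólya's urn) carries the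
uniform distribution on each level to the uniform distribution on the next one. -/
lemma sum_level_succ (e k : ℕ) (V : (ℕ → ℕ) → ℝ) :
    ∑ n ∈ level e k, ∑ i ∈ Finset.range (e + 1), ((n i : ℝ) + 1) * V (bump n i)
      = (k + 1) * ∑ m ∈ level e (k + 1), V m := by
  have h1 : (k + 1 : ℝ) * ∑ m ∈ level e (k + 1), V m
      = ∑ m ∈ level e (k + 1), ∑ i ∈ Finset.range (e + 1), (m i : ℝ) * V m := by
    rw [Finset.mul_sum]
    refine Finset.sum_congr rfl fun m hm => ?_
    rw [← Finset.sum_mul, ← Nat.cast_sum, (mem_level.mp hm).1]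
    push_cast
    rfl
  rw [h1, Finset.sum_comm, Finset.sum_comm (s := level e (k + 1))]
  refine Finset.sum_congr rfl fun i hi => ?_
  rw [Finset.mem_range] at hi
  rw [← Finset.sum_filter_of_ne (s := level e (k + 1)) (p := fun m => m i ≠ 0)
    fun m _ hne h0 => hne (by simp [h0])]
  refine Finset.sum_bij' (fun n _ => bump n i) (fun m _ => Function.update m i (m i - 1))
    ?_ ?_ ?_ ?_ ?_
  · intro n hn
    exact Finset.mem_filter.mpr ⟨bump_mem_level hn hi, by simp [bump]⟩
  · intro m hm
    obtain ⟨hm, h0⟩ := Finset.mem_filter.mp hm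
    have hb : bump (Function.update m i (m i - 1)) i = m := by
      simp [bump, Nat.sub_add_cancel (Nat.pos_of_ne_zero h0)]
    rw [mem_level] at hm ⊢
    refine ⟨?_, fun j hj => ?_⟩
    · have := sum_bump (Function.update m i (m i - 1)) hi
      rw [hb, hm.1] at this
      omega
    · by_cases hji : j = i
      · exact hji ▸ hi
      · exact hm.2 j (by rwa [Function.update_of_ne hji] at hj)
  · intro n _
    simp [bump]
  · intro m hm
    obtain ⟨hm, h0⟩ := Finset.mem_filter.mp hm
    simp [bump, Nat.sub_add_cancel (Nat.pos_of_ne_zero h0)]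
  · intro n _
    simp [bump]

lemma level_zero (e : ℕ) : level e 0 = {0} := by simp [level]

lemma card_level_succ (e k : ℕ) :
    ((k : ℝ) + e + 1) * (level e k).card = (k + 1) * (level e (k + 1)).card := by
  have h := sum_level_succ e k fun _ => 1
  simp only [mul_one, Finset.sum_const, nsmul_eq_mul] at h
  rw [← h, mul_comm, ← nsmul_eq_mul, ← Finset.sum_const]
  refine Finset.sum_congr rfl fun n hn => ?_
  rw [Finset.sum_add_distrib, ← Nat.cast_sum, (mem_level.mp hn).1]
  simp [add_assoc]

lemma card_level (e k : ℕ) : (level e k).card = (k + e).choose k := by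
  induction k with
  | zero => simp [level_zero]
  | succ k ih =>
    have h := card_level_succ e k
    rw [ih] at h
    have h2 := Nat.add_one_mul_choose_eq (k + e) k
    have h3 : (k + 1) * (level e (k + 1)).card = (k + 1) * (k + 1 + e).choose (k + 1) := by
      have : (k + e + 1) * (k + e).choose k = (k + 1) * (level e (k + 1)).card := by
        exact_mod_cast h
      rw [← this, show k + 1 + e = k + e + 1 by ring, h2, mul_comm]
    exact Nat.eq_of_mul_eq_mul_left k.succ_pos h3

lemma pow_le_card_level (e k : ℕ) :
    ((k : ℝ) + 1) ^ e / e.factorial ≤ (level e k).card := by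
  rw [card_level, Nat.choose_symm_add]
  have h := Nat.pow_le_choose (α := ℝ) e (k + e)
  rwa [show k + e + 1 - e = k + 1 by omega, Nat.cast_add, Nat.cast_one] at h

/-- The least total cost `c n⁰ + ⋯ + c nʳ⁻¹` of a path of `r` unit steps
`n = n⁰ → n¹ → ⋯ → nʳ` in `ℕ ^ (e + 1)`. -/
noncomputable def minCost (e : ℕ) (c : (ℕ → ℕ) → ℝ) : ℕ → (ℕ → ℕ) → ℝ
  | 0, _ => 0
  | r + 1, n => c n + (Finset.range (e + 1)).inf' ⟨0, by simp⟩ fun i => minCost e c r (bump n i)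

lemma minCost_succ_le {e i : ℕ} (c : (ℕ → ℕ) → ℝ) (r : ℕ) (n : ℕ → ℕ) (hi : i < e + 1) :
    minCost e c (r + 1) n ≤ c n + minCost e c r (bump n i) := by
  rw [minCost]
  gcongr
  exact Finset.inf'_le _ (Finset.mem_range.mpr hi)

lemma exists_minCost_succ_eq (e : ℕ) (c : (ℕ → ℕ) → ℝ) (r : ℕ) (n : ℕ → ℕ) :
    ∃ i < e + 1, minCost e c (r + 1) n = c n + minCost e c r (bump n i) := by
  obtain ⟨i, hi, h⟩ := Finset.exists_mem_eq_inf' (s := Finset.range (e + 1)) ⟨0, by simp⟩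
    fun i => minCost e c r (bump n i)
  exact ⟨i, Finset.mem_range.mp hi, by rw [minCost, h]⟩

/-- The average over the level `k` of the least cost is at most the sum of the averages of the cost
over the levels visited: the cheapest path is no worse than the random one of Pólya's urn. -/
lemma average_minCost_le (e : ℕ) (c : (ℕ → ℕ) → ℝ) (r k : ℕ) :
    (∑ n ∈ level e k, minCost e c r n) / (level e k).card
      ≤ ∑ j ∈ Finset.range r, (∑ n ∈ level e (k + j), c n) / (level e (k + j)).card := by
  have hN : ∀ k, (0 : ℝ) < (level e k).card := fun k =>
    (by positivity : (0 : ℝ) < (k + 1) ^ e / e.factorial).trans_le (pow_le_card_level e k)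
  induction r generalizing k with
  | zero => simp [minCost]
  | succ r ih =>
    have h1 : ((k : ℝ) + e + 1) * ∑ n ∈ level e k, minCost e c (r + 1) n
        ≤ (k + e + 1) * ∑ n ∈ level e k, c n
          + (k + 1) * ∑ m ∈ level e (k + 1), minCost e c r m := by
      rw [← sum_level_succ, Finset.mul_sum, Finset.mul_sum, ← Finset.sum_add_distrib]
      refine Finset.sum_le_sum fun n hn => ?_
      have h2 : (k + e + 1 : ℝ) = ∑ i ∈ Finset.range (e + 1), ((n i : ℝ) + 1) := by
        rw [Finset.sum_add_distrib, ← Nat.cast_sum, (mem_level.mp hn).1]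
        simp [add_assoc]
      rw [h2, Finset.sum_mul, Finset.sum_mul, ← Finset.sum_add_distrib]
      refine Finset.sum_le_sum fun i hi => ?_
      rw [← mul_add]
      exact mul_le_mul_of_nonneg_left (minCost_succ_le c r n (Finset.mem_range.mp hi))
        (by positivity)
    have h3 : (∑ n ∈ level e k, minCost e c (r + 1) n) / (level e k).card
        ≤ (∑ n ∈ level e k, c n) / (level e k).card
          + (∑ m ∈ level e (k + 1), minCost e c r m) / (level e (k + 1)).card := by
      have hk := hN k
      have hk' := hN (k + 1)
      have hc := card_level_succ e k
      have hd : (0 : ℝ) < k + e + 1 := by positivity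
      have h4 : (∑ m ∈ level e (k + 1), minCost e c r m) / (level e (k + 1)).card
          = ((k + 1) * ∑ m ∈ level e (k + 1), minCost e c r m)
            / ((k + e + 1) * (level e k).card) := by
        rw [hc, mul_div_mul_left _ _ (by positivity)]
      have h5 : ∀ x : ℝ, x / (level e k).card
          = ((k + e + 1) * x) / ((k + e + 1) * (level e k).card) := fun x =>
        (mul_div_mul_left _ _ hd.ne').symm
      rw [h4, h5, h5 (∑ n ∈ level e k, c n), ← add_div]
      exact div_le_div_of_nonneg_right h1 (by positivity)
    refine h3.trans ?_
    rw [Finset.sum_range_succ', add_comm]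
    refine add_le_add ((ih (k + 1)).trans_eq ?_) le_rfl
    refine Finset.sum_congr rfl fun j _ => ?_
    rw [show k + 1 + j = k + (j + 1) by ring]

/-- If the dimension is large compared with `1 / β`, then for disjoint intervals of total length at
most `Λ` indexed by `ℕ ^ (e + 1)`, there are paths of any length along which the sum of the `β`-th
powers of the lengths is bounded. -/
lemma exists_minCost_le {e : ℕ} {β : ℝ} (hβ : 0 < β) (hβ1 : β ≤ 1) (he : 2 ≤ e * β) {Λ : ℝ}
    (hΛ : 0 ≤ Λ) (len : (ℕ → ℕ) → ℝ) (h0 : ∀ n, 0 ≤ len n)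
    (hsum : ∀ k, ∑ n ∈ level e k, len n ≤ Λ) :
    ∃ C, ∀ r, minCost e (fun n => len n ^ β) r 0 ≤ C := by
  have hN : ∀ k, (0 : ℝ) < (level e k).card := fun k =>
    (by positivity : (0 : ℝ) < (k + 1) ^ e / e.factorial).trans_le (pow_le_card_level e k)
  have havg : ∀ k, (∑ n ∈ level e k, len n ^ β) / (level e k).card
      ≤ (Λ * e.factorial) ^ β * (1 / ((k + 1 : ℕ) : ℝ) ^ 2) := by
    intro k
    have hj : (∑ n ∈ level e k, len n ^ β) / (level e k).card
        ≤ ((∑ n ∈ level e k, len n) / (level e k).card) ^ β := by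
      have := (Real.concaveOn_rpow hβ.le hβ1).le_map_sum (t := level e k)
        (w := fun _ => ((level e k).card : ℝ)⁻¹) (p := len) (fun _ _ => by positivity)
        (by rw [Finset.sum_const, nsmul_eq_mul, mul_inv_cancel₀ (hN k).ne']) fun n _ => h0 n
      simp only [smul_eq_mul, ← Finset.mul_sum] at this
      rwa [div_eq_inv_mul, div_eq_inv_mul]
    have hq : (∑ n ∈ level e k, len n) / (level e k).card ≤ Λ * e.factorial / (k + 1) ^ e := by
      calc _ ≤ Λ / (level e k).card := div_le_div_of_nonneg_right (hsum k) (hN k).le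
        _ ≤ Λ / ((k + 1) ^ e / e.factorial) :=
          div_le_div_of_nonneg_left hΛ (by positivity) (pow_le_card_level e k)
        _ = _ := by rw [div_div_eq_mul_div]
    refine hj.trans ((Real.rpow_le_rpow
      (div_nonneg (Finset.sum_nonneg fun n _ => h0 n) (hN k).le) hq hβ.le).trans ?_)
    rw [Real.div_rpow (by positivity) (by positivity), div_eq_mul_one_div]
    refine mul_le_mul_of_nonneg_left ?_ (by positivity)
    refine one_div_le_one_div_of_le (by positivity) ?_
    rw [← Real.rpow_natCast ((k : ℝ) + 1) e, ← Real.rpow_mul (by positivity), Nat.cast_add,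
      Nat.cast_one, ← Real.rpow_natCast _ 2]
    exact Real.rpow_le_rpow_of_exponent_le (by linarith [(Nat.cast_nonneg k : (0 : ℝ) ≤ k)])
      (by simpa using he)
  have hs : Summable fun k : ℕ => (Λ * e.factorial) ^ β * (1 / ((k + 1 : ℕ) : ℝ) ^ 2) :=
    (((summable_nat_add_iff 1).mpr
      (Real.summable_one_div_nat_pow.mpr one_lt_two)).mul_left _)
  refine ⟨∑' k : ℕ, (Λ * e.factorial) ^ β * (1 / ((k + 1 : ℕ) : ℝ) ^ 2), fun r => ?_⟩
  have h := average_minCost_le e (fun n => len n ^ β) r 0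
  rw [level_zero, Finset.sum_singleton, Finset.card_singleton, Nat.cast_one, div_one] at h
  refine h.trans ((Finset.sum_le_sum fun j _ => ?_).trans
    (hs.sum_le_tsum (Finset.range r) fun j _ => by positivity))
  rw [zero_add]
  exact havg j

/-! ### Hölder control of the logarithm of the derivative -/

/-- All elements of `A` are of class `C¹` with locally `β`-Hölder derivative. -/
def IsHolderSubgroup (β : ℝ) (A : Subgroup (ℝ ≃ₜ ℝ)) : Prop :=
  ∀ a ∈ A, ContDiff ℝ 1 (a : ℝ → ℝ) ∧ IsLocallyHolder β (deriv (a : ℝ → ℝ))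

lemma IsHolderSubgroup.deriv_pos {β : ℝ} {A : Subgroup (ℝ ≃ₜ ℝ)} (hreg : IsHolderSubgroup β A)
    (hA : A ≤ homeoPlus) {a : ℝ ≃ₜ ℝ} (ha : a ∈ A) (x : ℝ) : 0 < deriv (a : ℝ → ℝ) x := by
  have hd := ((hreg a ha).1.differentiable one_ne_zero) x
  have hd' := ((hreg _ (A.inv_mem ha)).1.differentiable one_ne_zero) (a x)
  refine lt_of_le_of_ne (homeoPlus_strictMono (hA ha)).monotone.deriv_nonneg fun h0 => ?_
  have h1 := hd'.hasDerivAt.comp x hd.hasDerivAt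
  rw [← h0, mul_zero] at h1
  have h2 : ((a⁻¹ : ℝ ≃ₜ ℝ) : ℝ → ℝ) ∘ a = id := by
    ext y
    rw [Function.comp_apply, inv_apply_apply, id]
  rw [h2] at h1
  exact zero_ne_one (h1.unique (hasDerivAt_id x))

lemma abs_log_sub_log_le {m u v : ℝ} (hm : 0 < m) (hu : m ≤ u) (hv : m ≤ v) :
    |Real.log u - Real.log v| ≤ |u - v| / m := by
  have key : ∀ u v : ℝ, m ≤ u → m ≤ v → Real.log u - Real.log v ≤ |u - v| / m := by
    intro u v hu hv
    have hu0 := hm.trans_le hu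
    have hv0 := hm.trans_le hv
    rw [← Real.log_div hu0.ne' hv0.ne']
    calc Real.log (u / v) ≤ u / v - 1 := Real.log_le_sub_one_of_pos (div_pos hu0 hv0)
      _ = (u - v) / v := by rw [sub_div, div_self hv0.ne']
      _ ≤ |u - v| / v := div_le_div_of_nonneg_right (le_abs_self _) hv0.le
      _ ≤ |u - v| / m := div_le_div_of_nonneg_left (abs_nonneg _) hm hv
  refine abs_sub_le_iff.mpr ⟨key u v hu hv, ?_⟩
  rw [abs_sub_comm]
  exact key v u hv hu

lemma IsHolderSubgroup.exists_log_deriv_le {β : ℝ} {A : Subgroup (ℝ ≃ₜ ℝ)}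
    (hreg : IsHolderSubgroup β A) (hA : A ≤ homeoPlus) {a : ℝ ≃ₜ ℝ} (ha : a ∈ A) {l r : ℝ}
    (hlr : l ≤ r) : ∃ H, 0 ≤ H ∧ ∀ s ∈ Set.Icc l r, ∀ t ∈ Set.Icc l r,
      |Real.log (deriv (a : ℝ → ℝ) s) - Real.log (deriv (a : ℝ → ℝ) t)| ≤ H * |s - t| ^ β := by
  obtain ⟨C, hC⟩ := (hreg a ha).2 l r
  obtain ⟨z, -, hz⟩ := isCompact_Icc.exists_isMinOn (Set.nonempty_Icc.mpr hlr)
    ((hreg a ha).1.continuous_deriv le_rfl).continuousOn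
  have hm := hreg.deriv_pos hA ha z
  refine ⟨|C| / deriv (a : ℝ → ℝ) z, by positivity, fun s hs t ht => ?_⟩
  refine (abs_log_sub_log_le hm (hz hs) (hz ht)).trans ?_
  rw [div_mul_eq_mul_div]
  refine div_le_div_of_nonneg_right ((hC s hs t ht).trans ?_) hm.le
  exact mul_le_mul_of_nonneg_right (le_abs_self C) (by positivity)

/-! ### A lemma of Kopell type for towers -/

namespace IsTower

variable {A : Subgroup (ℝ ≃ₜ ℝ)} {F : Set ℝ} {a : ℕ → ℝ ≃ₜ ℝ} {p q : ℕ → ℝ}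

/-- Following a path of least cost gives compositions `u` of elements of the tower whose distortion
on the image of the block `0` is controlled by the cost. -/
lemma exists_distortion_le (T : IsTower A F a p q) (h : ActsCommutativelyOn A F) {β : ℝ}
    (hreg : IsHolderSubgroup β A) (hβ : 0 < β) (e : ℕ) {H : ℝ} (hH : 0 ≤ H)
    (hlog : ∀ i < e + 1, ∀ s ∈ Set.Icc (p (e + 1)) (q (e + 1)),
      ∀ t ∈ Set.Icc (p (e + 1)) (q (e + 1)),
      |Real.log (deriv (a i : ℝ → ℝ) s) - Real.log (deriv (a i : ℝ → ℝ) t)| ≤ H * |s - t| ^ β)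
    (r k : ℕ) (n : ℕ → ℕ) (hn : n ∈ level e k) :
    ∃ u ∈ A, (∃ m ∈ level e (k + r), ∀ y ∈ F, u (word a n (e + 1) y) = word a m (e + 1) y) ∧
      ∀ s ∈ Set.Icc (word a n (e + 1) (p 0)) (word a n (e + 1) (q 0)),
      ∀ t ∈ Set.Icc (word a n (e + 1) (p 0)) (word a n (e + 1) (q 0)),
        |Real.log (deriv (u : ℝ → ℝ) s) - Real.log (deriv (u : ℝ → ℝ) t)|
          ≤ H * minCost e (fun n => (word a n (e + 1) (q 0) - word a n (e + 1) (p 0)) ^ β) r n := by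
  induction r generalizing k n with
  | zero =>
    refine ⟨1, A.one_mem, ⟨n, hn, fun y _ => rfl⟩, fun s _ t _ => ?_⟩
    have : ((1 : ℝ ≃ₜ ℝ) : ℝ → ℝ) = id := rfl
    simp [minCost, this]
  | succ r ih =>
    obtain ⟨i, hi, hcost⟩ := exists_minCost_succ_eq e
      (fun n => (word a n (e + 1) (q 0) - word a n (e + 1) (p 0)) ^ β) r n
    obtain ⟨u, hu, ⟨m, hm, hum⟩, hdist⟩ := ih (k + 1) (bump n i) (bump_mem_level hn hi)
    have hstep : ∀ y ∈ F, word a (bump n i) (e + 1) y = a i (word a n (e + 1) y) := fun y hy =>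
      word_update h T.mem n hi hy
    refine ⟨u * a i, A.mul_mem hu (T.mem i), ⟨m, ?_, fun y hy => ?_⟩, fun s hs t ht => ?_⟩
    · rwa [show k + (r + 1) = k + 1 + r by ring]
    · rw [Homeomorph.mul_apply, ← hstep y hy, hum y hy]
    · have hder : ∀ x, Real.log (deriv ((u * a i : ℝ ≃ₜ ℝ) : ℝ → ℝ) x)
          = Real.log (deriv (u : ℝ → ℝ) (a i x)) + Real.log (deriv (a i : ℝ → ℝ) x) := by
        intro x
        have h1 := ((hreg u hu).1.differentiable one_ne_zero (a i x)).hasDerivAt.comp x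
          ((hreg _ (T.mem i)).1.differentiable one_ne_zero x).hasDerivAt
        have h2 : ((u * a i : ℝ ≃ₜ ℝ) : ℝ → ℝ) = (u : ℝ → ℝ) ∘ (a i : ℝ → ℝ) := rfl
        rw [h2, h1.deriv, Real.log_mul (hreg.deriv_pos h.le_homeoPlus hu _).ne'
          (hreg.deriv_pos h.le_homeoPlus (T.mem i) _).ne']
      have hmono := (h.strictMono (T.mem i)).monotone
      have hmap : ∀ x ∈ Set.Icc (word a n (e + 1) (p 0)) (word a n (e + 1) (q 0)),
          a i x ∈ Set.Icc (word a (bump n i) (e + 1) (p 0)) (word a (bump n i) (e + 1) (q 0)) := by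
        intro x hx
        rw [hstep _ (T.block 0).left_mem, hstep _ (T.block 0).right_mem]
        exact ⟨hmono hx.1, hmono hx.2⟩
      have hin : ∀ x ∈ Set.Icc (word a n (e + 1) (p 0)) (word a n (e + 1) (q 0)),
          x ∈ Set.Icc (p (e + 1)) (q (e + 1)) := fun x hx =>
        have hb := T.word_bounds h.le_homeoPlus n (e + 1)
        ⟨hb.1.trans hx.1, hx.2.trans hb.2⟩
      have h1 := hdist _ (hmap s hs) _ (hmap t ht)
      have h2 := hlog i hi s (hin s hs) t (hin t ht)
      have h3 : |s - t| ^ β ≤ (word a n (e + 1) (q 0) - word a n (e + 1) (p 0)) ^ β :=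
        Real.rpow_le_rpow (abs_nonneg _)
          (abs_sub_le_iff.mpr ⟨by linarith [hs.2, ht.1], by linarith [hs.1, ht.2]⟩) hβ.le
      rw [hder, hder, hcost, mul_add, add_sub_add_comm, add_comm (H * _)]
      exact (abs_add_le _ _).trans
        (add_le_add h1 (h2.trans (mul_le_mul_of_nonneg_left h3 hH)))

/-- The images of the block `0` at a deep enough level are uniformly short: otherwise one long image
at each level would give an infinite total length. -/
lemma exists_level_length_lt (T : IsTower A F a p q) (hA : A ≤ homeoPlus) (e : ℕ) {ε : ℝ}
    (hε : 0 < ε) :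
    ∃ r, ∀ n ∈ level e r, word a n (e + 1) (q 0) - word a n (e + 1) (p 0) < ε := by
  classical
  by_contra! hcon
  choose m hm hlen using hcon
  have hinj : Function.Injective m := fun r s hrs => by
    rw [← (mem_level.mp (hm r)).1, hrs, (mem_level.mp (hm s)).1]
  obtain ⟨R, hR⟩ := exists_nat_gt ((q (e + 1) - p (e + 1)) / ε)
  rw [div_lt_iff₀ hε] at hR
  have h1 := T.sum_word_length_le hA (e + 1) ((Finset.range R).image m) fun n hn => by
    obtain ⟨r, -, rfl⟩ := Finset.mem_image.mp hn
    exact (mem_level.mp (hm r)).2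
  rw [Finset.sum_image fun r _ s _ hrs => hinj hrs] at h1
  have h2 := Finset.card_nsmul_le_sum (Finset.range R) _ ε fun r _ => hlen r
  rw [Finset.card_range, nsmul_eq_mul] at h2
  linarith

end IsTower

lemma exists_iterate_length_lt {f : ℝ ≃ₜ ℝ} (hf : StrictMono f) {x q : ℝ}
    (hxq : x ≤ q) (hq : f q = q) {δ : ℝ} (hδ : 0 < δ) :
    ∃ m : ℕ, (f ^ m) (f x) - (f ^ m) x < δ := by
  have hle : ∀ m : ℕ, (f ^ m) x ≤ q := fun m => by
    induction m with
    | zero => exact hxq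
    | succ m ih =>
      rw [pow_succ', Homeomorph.mul_apply]
      exact (hf.monotone ih).trans_eq hq
  by_contra! hcon
  have hge : ∀ m : ℕ, x + m * δ ≤ (f ^ m) x := fun m => by
    induction m with
    | zero => simp
    | succ m ih =>
      have := hcon m
      rw [pow_succ, Homeomorph.mul_apply]
      push_cast
      linarith
  obtain ⟨m, hm⟩ := exists_nat_gt ((q - x) / δ)
  rw [div_lt_iff₀ hδ] at hm
  linarith [hge m, hle m]

lemma exists_deriv_mul_eq {f : ℝ → ℝ} (hf : ContDiff ℝ 1 f) {x y : ℝ} (hxy : x < y) :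
    ∃ z ∈ Set.Ioo x y, deriv f z * (y - x) = f y - f x := by
  obtain ⟨z, hz, h⟩ := exists_deriv_eq_slope f hxy hf.continuous.continuousOn
    (hf.differentiable one_ne_zero).differentiableOn
  exact ⟨z, hz, by rw [h, div_mul_cancel₀ _ (sub_pos.mpr hxy).ne']⟩

/-- A generalization of Kopell's lemma. Words `u` of bounded distortion shrink the block `0`
arbitrarily, so that any fixed iterate `f ^ m` has derivative at least `1 / 2` on its image; as `u`
commutes with `f ^ m` on `F`, the iterates of `f` cannot contract the interval `[x, f x]`. -/
lemma IsTower.false_of_moved {A : Subgroup (ℝ ≃ₜ ℝ)} {F : Set ℝ} {a : ℕ → ℝ ≃ₜ ℝ} {p q : ℕ → ℝ}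
    (T : IsTower A F a p q) (h : ActsCommutativelyOn A F) {β : ℝ} (hreg : IsHolderSubgroup β A)
    (hβ : 0 < β) (hβ1 : β ≤ 1) {f : ℝ ≃ₜ ℝ} (hf : f ∈ A) (hfp : f (p 0) = p 0)
    (hfq : f (q 0) = q 0) {x : ℝ} (hx : x ∈ F) (hpx : p 0 < x) (hxq : x < q 0)
    (hfx : x < f x) : False := by
  have hA := h.le_homeoPlus
  obtain ⟨e, he⟩ := exists_nat_ge (2 / β)
  rw [div_le_iff₀ hβ] at he
  have hpq := (T.block (e + 1)).lt
  -- one Hölder constant for the logarithmic derivatives of all the generators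
  obtain ⟨H, hH, hlog⟩ : ∃ H, 0 ≤ H ∧ ∀ i < e + 1, ∀ s ∈ Set.Icc (p (e + 1)) (q (e + 1)),
      ∀ t ∈ Set.Icc (p (e + 1)) (q (e + 1)),
      |Real.log (deriv (a i : ℝ → ℝ) s) - Real.log (deriv (a i : ℝ → ℝ) t)|
        ≤ H * |s - t| ^ β := by
    choose H hH0 hH using fun i => hreg.exists_log_deriv_le hA (T.mem i) hpq.le
    refine ⟨∑ i ∈ Finset.range (e + 1), H i, Finset.sum_nonneg fun i _ => hH0 i,
      fun i hi s hs t ht => (hH i s hs t ht).trans (mul_le_mul_of_nonneg_right ?_ (by positivity))⟩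
    exact Finset.single_le_sum (fun i _ => hH0 i) (Finset.mem_range.mpr hi)
  obtain ⟨C, hC⟩ := exists_minCost_le hβ hβ1 he (sub_nonneg.mpr hpq.le)
    (fun n => word a n (e + 1) (q 0) - word a n (e + 1) (p 0))
    (fun n => sub_nonneg.mpr
      ((homeoPlus_strictMono (hA (word_mem T.mem n _))).monotone (T.block 0).lt.le))
    (fun k => T.sum_word_length_le hA (e + 1) (level e k) fun n hn => (mem_level.mp hn).2)
  set D := Real.exp (H * C) with hDdef
  have hD : 0 < D := Real.exp_pos _
  -- `m` is such that `f ^ m` contracts `[x, f x]` more than a map of distortion `D` can undo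
  obtain ⟨m, hm⟩ := exists_iterate_length_lt (h.strictMono hf) hxq.le hfq
    (δ := (f x - x) / (2 * D)) (div_pos (sub_pos.mpr hfx) (by positivity))
  have hg : f ^ m ∈ A := A.pow_mem hf m
  have hgfix : ∀ y, f y = y → (f ^ m) y = y := fun y hy => by
    clear hm hg
    induction m with
    | zero => rfl
    | succ m ih => rw [pow_succ, Homeomorph.mul_apply, hy, ih]
  generalize f ^ m = g at hm hg hgfix
  -- as `g = f ^ m` preserves the images of the block `0`, its derivative equals one somewhere on
  -- each of them, hence is at least `1 / 2` on the whole of those shorter than `ε`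
  obtain ⟨ε, hε, hcont⟩ := Metric.uniformContinuousOn_iff.mp
    (isCompact_Icc.uniformContinuousOn_of_continuous
      ((hreg g hg).1.continuous_deriv le_rfl).continuousOn (s := Set.Icc (p (e + 1)) (q (e + 1))))
    (1 / 2) (by norm_num)
  -- the length `r` of the word `u` is chosen after `m`, while `D` depends on neither
  obtain ⟨r, hr⟩ := T.exists_level_length_lt hA e hε
  obtain ⟨u, hu, ⟨n, hn, hun⟩, hdist⟩ :=
    T.exists_distortion_le h hreg hβ e hH hlog r 0 0 (by simp [level_zero])
  rw [zero_add] at hn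
  have hw0 : word a 0 (e + 1) = 1 := by
    generalize e + 1 = d
    induction d with
    | zero => rfl
    | succ d ih => rw [word, ih]; rfl
  simp only [hw0, Homeomorph.one_apply] at hun hdist
  have hum := h.strictMono hu
  have hgm := h.strictMono hg
  have hpF := (T.block 0).left_mem
  have hqF := (T.block 0).right_mem
  have hfxq : f x < q 0 := (h.strictMono hf hxq).trans_eq hfq
  have hfxF := h.mapsTo f hf x hx
  have hlen : u (q 0) - u (p 0) < ε := by rw [hun _ hpF, hun _ hqF]; exact hr n hn
  have hub : p (e + 1) ≤ u (p 0) ∧ u (q 0) ≤ q (e + 1) := by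
    rw [hun _ hpF, hun _ hqF]; exact T.word_bounds hA n (e + 1)
  have hugp : g (u (p 0)) = u (p 0) := by
    rw [h.comm g hg u hu _ hpF, hgfix _ hfp]
  have hugq : g (u (q 0)) = u (q 0) := by
    rw [h.comm g hg u hu _ hqF, hgfix _ hfq]
  obtain ⟨z₁, hz₁, h₁⟩ := exists_deriv_mul_eq (hreg g hg).1 (hum (T.block 0).lt)
  obtain ⟨z₂, hz₂, h₂⟩ := exists_deriv_mul_eq (hreg g hg).1 (hum hfx)
  obtain ⟨s, hs, h₃⟩ := exists_deriv_mul_eq (hreg u hu).1 (hgm hfx)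
  obtain ⟨t, ht, h₄⟩ := exists_deriv_mul_eq (hreg u hu).1 hfx
  have hd₁ : deriv (g : ℝ → ℝ) z₁ = 1 := by
    rw [hugp, hugq] at h₁
    exact mul_right_cancel₀ (sub_pos.mpr (hum (T.block 0).lt)).ne' (by rw [h₁, one_mul])
  have hup := hum hpx
  have huq := hum hfxq
  have hd₂ : 1 / 2 ≤ deriv (g : ℝ → ℝ) z₂ := by
    have := hcont z₁ ⟨by linarith [hz₁.1], by linarith [hz₁.2]⟩ z₂
      ⟨by linarith [hz₂.1], by linarith [hz₂.2]⟩ (by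
        rw [Real.dist_eq, abs_sub_lt_iff]
        constructor <;> linarith [hz₁.1, hz₁.2, hz₂.1, hz₂.2])
    rw [Real.dist_eq, hd₁, abs_sub_lt_iff] at this
    linarith
  have hgx : p 0 < g x := (hgfix _ hfp).symm.trans_lt (hgm hpx)
  have hgfx : g (f x) < q 0 := (hgm hfxq).trans_eq (hgfix _ hfq)
  have hdst : deriv (u : ℝ → ℝ) s ≤ D * deriv (u : ℝ → ℝ) t := by
    have h5 := (le_abs_self _).trans (hdist s ⟨by linarith [hs.1], by linarith [hs.2]⟩ t
      ⟨by linarith [ht.1], by linarith [ht.2]⟩)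
    have h6 := h5.trans (mul_le_mul_of_nonneg_left (hC r) hH)
    have hps := hreg.deriv_pos hA hu s
    have hpt := hreg.deriv_pos hA hu t
    rw [← Real.log_div hps.ne' hpt.ne', Real.log_le_iff_le_exp (div_pos hps hpt),
      div_le_iff₀ hpt] at h6
    exact h6
  rw [h.comm u hu g hg _ hfxF, h.comm u hu g hg _ hx, ← h₂, ← h₄] at h₃
  have hpt := hreg.deriv_pos hA hu t
  rw [lt_div_iff₀ (by positivity)] at hm
  have hfx' := sub_pos.mpr hfx
  have hgl := sub_pos.mpr (hgm hfx)
  have e1 : 1 / 2 * (deriv (u : ℝ → ℝ) t * (f x - x))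
      ≤ D * deriv (u : ℝ → ℝ) t * (g (f x) - g x) := by
    calc _ ≤ deriv (g : ℝ → ℝ) z₂ * (deriv (u : ℝ → ℝ) t * (f x - x)) :=
          mul_le_mul_of_nonneg_right hd₂ (by positivity)
      _ = deriv (u : ℝ → ℝ) s * (g (f x) - g x) := h₃.symm
      _ ≤ _ := mul_le_mul_of_nonneg_right hdst hgl.le
  have e2 : deriv (u : ℝ → ℝ) t * ((g (f x) - g x) * (2 * D))
      < deriv (u : ℝ → ℝ) t * (f x - x) := mul_lt_mul_of_pos_left hm hpt
  linarith

/-- A group of `C^{1 + β}` diffeomorphisms acting commutatively on a closed set, without a common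
fixed point there, contains an element without fixed points in that set. -/
theorem ActsCommutativelyOn.exists_fixedPointFree {A : Subgroup (ℝ ≃ₜ ℝ)} {F : Set ℝ}
    (h : ActsCommutativelyOn A F) (hF : F.Nonempty) {β : ℝ} (hreg : IsHolderSubgroup β A)
    (hβ : 0 < β) (hβ1 : β ≤ 1) : ∃ a ∈ A, ∀ x ∈ F, a x ≠ x := by
  by_contra! hfix
  obtain ⟨x, hx⟩ := hF
  obtain ⟨f, hf, hfx⟩ : ∃ f ∈ A, x < f x := by
    obtain ⟨f, hf, hfx⟩ := h.exists_moved x hx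
    rcases hfx.lt_or_gt with h1 | h1
    · refine ⟨f⁻¹, A.inv_mem hf, ?_⟩
      have h2 := h.strictMono (A.inv_mem hf) h1
      rwa [inv_apply_apply] at h2
    · exact ⟨f, hf, h1⟩
  obtain ⟨z, hz, hfz⟩ := hfix f hf
  obtain ⟨p₀, q₀, hb, hpx, hxq, hp, hq⟩ := h.exists_block hf hz hfz hfx.ne'
  obtain ⟨a, p, q, T, rfl, rfl⟩ := h.exists_tower hfix hb
  exact T.false_of_moved h hreg hβ hβ1 hf hp hq hx hpx hxq hfx

/-! ### Homeomorphisms without fixed points -/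

/-- The pointwise stabilizer of `K`. -/
def fixator (K : Set ℝ) : Subgroup (ℝ ≃ₜ ℝ) where
  carrier := {g | ∀ x ∈ K, g x = x}
  mul_mem' := fun {f g} hf hg x hx => by rw [Homeomorph.mul_apply, hg x hx, hf x hx]
  one_mem' := fun _ _ => rfl
  inv_mem' := fun {g} hg x hx => by
    conv_lhs => rw [← hg x hx]
    exact inv_apply_apply g x

lemma IsClosedInvariant.map_mem {G : Subgroup (ℝ ≃ₜ ℝ)} {K : Set ℝ} (hK : IsClosedInvariant G K)
    {g : ℝ ≃ₜ ℝ} (hg : g ∈ G) {x : ℝ} (hx : x ∈ K) : g x ∈ K :=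
  hK.2.2 g hg ▸ Set.mem_image_of_mem _ hx

lemma image_eq_of_forall_map_mem {G : Subgroup (ℝ ≃ₜ ℝ)} {K : Set ℝ}
    (h : ∀ g ∈ G, ∀ x ∈ K, g x ∈ K) : ∀ g ∈ G, (g : ℝ → ℝ) '' K = K := fun g hg =>
  Set.Subset.antisymm (Set.image_subset_iff.mpr (h g hg)) fun x hx =>
    ⟨g⁻¹ x, h _ (G.inv_mem hg) x hx, apply_inv_apply g x⟩

/-- A homeomorphism without fixed points in an invariant nonempty closed set has none at all. -/
lemma apply_ne_of_forall_mem {G : Subgroup (ℝ ≃ₜ ℝ)} (hG : G ≤ homeoPlus) {F : Set ℝ}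
    (hF : F.Nonempty) (hFc : IsClosed F) (hinv : ∀ g ∈ G, ∀ x ∈ F, g x ∈ F) {f : ℝ ≃ₜ ℝ}
    (hf : f ∈ G) (hfree : ∀ x ∈ F, f x ≠ x) (y : ℝ) : f y ≠ y := by
  intro hy
  have hmem : ∀ g ∈ Subgroup.zpowers f, g ∈ G := fun g hg =>
    (Subgroup.zpowers_le.mpr hf) hg
  have hle : Subgroup.zpowers f ≤ homeoPlus := fun g hg => hG (hmem g hg)
  have hfix : ∀ g ∈ Subgroup.zpowers f, g y = y := fun g hg =>
    (Subgroup.zpowers_le.mpr fun x hx => by rw [Set.mem_singleton_iff.mp hx, hy] :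
      Subgroup.zpowers f ≤ fixator {y}) hg y rfl
  obtain ⟨x, hx⟩ := hF
  rcases le_total x y with hxy | hxy
  · have hb : BddAbove (F ∩ Set.Iic y) := ⟨y, fun z hz => hz.2⟩
    have hne : (F ∩ Set.Iic y).Nonempty := ⟨x, hx, hxy⟩
    refine hfree _ ((hFc.inter isClosed_Iic).csSup_mem hne hb).1
      (map_sSup_eq_of_invariant hle hne hb (fun g hg z hz => ⟨hinv g (hmem g hg) z hz.1, ?_⟩) f
        (Subgroup.mem_zpowers f))
    exact ((homeoPlus_strictMono (hle hg)).monotone hz.2).trans_eq (hfix g hg)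
  · have hb : BddBelow (F ∩ Set.Ici y) := ⟨y, fun z hz => hz.2⟩
    have hne : (F ∩ Set.Ici y).Nonempty := ⟨x, hx, hxy⟩
    refine hfree _ ((hFc.inter isClosed_Ici).csInf_mem hne hb).1
      (map_sInf_eq_of_invariant hle hne hb (fun g hg z hz => ⟨hinv g (hmem g hg) z hz.1, ?_⟩) f
        (Subgroup.mem_zpowers f))
    exact (hfix g hg).symm.trans_le ((homeoPlus_strictMono (hle hg)).monotone hz.2)

lemma forall_lt_or_forall_gt {f : ℝ ≃ₜ ℝ} (hf : ∀ x, f x ≠ x) :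
    (∀ x, x < f x) ∨ ∀ x, f x < x := by
  by_contra! hcon
  obtain ⟨⟨x, hx⟩, y, hy⟩ := hcon
  obtain ⟨z, hz⟩ := mem_range_of_exists_le_of_exists_ge (f.continuous.sub continuous_id)
    ⟨x, sub_nonpos.mpr hx⟩ ⟨y, sub_nonneg.mpr hy⟩
  exact hf z (sub_eq_zero.mp hz)

/-- The orbits of a homeomorphism `f` with `x < f x` everywhere are unbounded. -/
lemma exists_lt_pow_apply {f : ℝ ≃ₜ ℝ} (hlt : ∀ x, x < f x) (x y : ℝ) :
    ∃ k : ℕ, y < (f ^ k) x := by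
  by_contra! hcon
  have hlim := tendsto_atTop_ciSup (f := fun k : ℕ => (f ^ k) x)
    (monotone_nat_of_le_succ fun k => by
      rw [pow_succ', Homeomorph.mul_apply]; exact (hlt _).le) ⟨y, fun z ⟨k, hk⟩ => hk ▸ hcon k⟩
  have h1 := (f.continuous.tendsto _).comp hlim
  have h2 : (f : ℝ → ℝ) ∘ (fun k : ℕ => (f ^ k) x) = fun k => (f ^ (k + 1)) x := by
    ext k
    rw [pow_succ', Homeomorph.mul_apply]
    rfl
  rw [h2] at h1
  exact (hlt _).ne (tendsto_nhds_unique ((Filter.tendsto_add_atTop_iff_nat 1).mpr hlim) h1)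

lemma pow_comm_apply {K : Set ℝ} {g h : ℝ ≃ₜ ℝ} (hh : ∀ x ∈ K, h x ∈ K)
    (hgh : ∀ x ∈ K, g (h x) = h (g x)) (n : ℕ) {x : ℝ} (hx : x ∈ K) :
    g ((h ^ n) x) = (h ^ n) (g x) := by
  induction n generalizing x with
  | zero => rfl
  | succ n ih => rw [pow_succ, Homeomorph.mul_apply, Homeomorph.mul_apply, ih (hh x hx), hgh x hx]

lemma pow_apply_mem {K : Set ℝ} {g : ℝ ≃ₜ ℝ} (hg : ∀ x ∈ K, g x ∈ K) (n : ℕ) {x : ℝ} (hx : x ∈ K) :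
    (g ^ n) x ∈ K := by
  induction n with
  | zero => exact hx
  | succ n ih => rw [pow_succ', Homeomorph.mul_apply]; exact hg _ ih

/-! ### Minimal closed invariant sets -/

section Minimal

variable {G : Subgroup (ℝ ≃ₜ ℝ)} {K : Set ℝ}

/-- Every nonempty closed invariant set meets the fundamental domain `[0, f 0]` of a fixed point
free element `f`, so Zorn's lemma applies. -/
lemma exists_isMinimalClosedInvariant (hG : G ≤ homeoPlus) {f : ℝ ≃ₜ ℝ} (hf : f ∈ G)
    (hlt : ∀ x, x < f x) : ∃ K, IsMinimalClosedInvariant G K := by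
  have hmeet : ∀ K, IsClosedInvariant G K → (K ∩ Set.Icc 0 (f 0)).Nonempty := by
    intro K hK
    obtain ⟨x, hx⟩ := hK.1
    obtain ⟨k, hk⟩ := exists_lt_pow_apply hlt x 0
    have hne : (K ∩ Set.Ici 0).Nonempty :=
      ⟨(f ^ k) x, hK.map_mem (G.pow_mem hf k) hx, hk.le⟩
    have hb : BddBelow (K ∩ Set.Ici (0 : ℝ)) := ⟨0, fun z hz => hz.2⟩
    obtain ⟨hyK, hy0⟩ := (hK.2.1.inter isClosed_Ici).csInf_mem hne hb
    refine ⟨_, hyK, hy0, ?_⟩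
    by_contra! hcon
    have h1 := (homeoPlus_strictMono (hG (G.inv_mem hf))) hcon
    rw [inv_apply_apply] at h1
    have h2 := csInf_le hb ⟨hK.map_mem (G.inv_mem hf) hyK, h1.le⟩
    have h3 := hlt (f⁻¹ (sInf (K ∩ Set.Ici 0)))
    rw [apply_inv_apply] at h3
    exact h2.not_gt h3
  obtain ⟨K, -, hK⟩ := zorn_superset_nonempty {K | IsClosedInvariant G K}
    (fun c hc hchain hcne => by
    have : Nonempty c := hcne.to_subtype
    have hI : (⋂ i : c, (i : Set ℝ) ∩ Set.Icc 0 (f 0)).Nonempty := by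
      refine IsCompact.nonempty_iInter_of_directed_nonempty_isCompact_isClosed _ ?_
        (fun i => hmeet _ (hc i.2)) (fun i => isCompact_Icc.inter_left (hc i.2).2.1)
        (fun i => (hc i.2).2.1.inter isClosed_Icc)
      intro i j
      rcases hchain.total i.2 j.2 with h | h
      · exact ⟨i, subset_rfl, Set.inter_subset_inter_left _ h⟩
      · exact ⟨j, Set.inter_subset_inter_left _ h, subset_rfl⟩
    obtain ⟨y, hy⟩ := hI
    rw [Set.mem_iInter] at hy
    refine ⟨⋂₀ c, ⟨⟨y, fun s hs => (hy ⟨s, hs⟩).1⟩, isClosed_sInter fun s hs => (hc hs).2.1,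
      image_eq_of_forall_map_mem fun g hg x hx s hs => (hc hs).map_mem hg (hx s hs)⟩,
      fun s hs => Set.sInter_subset_of_mem hs⟩) Set.univ
    ⟨Set.univ_nonempty, isClosed_univ, fun g _ => Set.image_univ_of_surjective g.surjective⟩
  exact ⟨K, hK⟩

/-- On a minimal set, an element commuting with the group acts trivially or freely. -/
lemma IsMinimalClosedInvariant.eq_of_fixed (hK : IsMinimalClosedInvariant G K) {c : ℝ ≃ₜ ℝ}
    (hcomm : ∀ g ∈ G, ∀ x ∈ K, c (g x) = g (c x)) {x : ℝ} (hx : x ∈ K) (hcx : c x = x) :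
    ∀ y ∈ K, c y = y := by
  have hinv := hK.prop
  have hS : IsClosedInvariant G (K ∩ {y | c y = y}) :=
    ⟨⟨x, hx, hcx⟩, hinv.2.1.inter (isClosed_eq c.continuous continuous_id),
      image_eq_of_forall_map_mem fun g hg y hy => ⟨hinv.map_mem hg hy.1, 
        (hcomm g hg y hy.1).trans (congrArg g hy.2)⟩⟩
  exact fun y hy => (hK.le_of_le hS Set.inter_subset_left hy).2

/-- If `h g = c g h` on `K` with `c` commuting with `g` and `h`, then `hⁿ gⁿ` is `c ^ n²` times
`gⁿ hⁿ`. Such a quadratic displacement is impossible, as `c` is cofinal and `g`, `h` displace a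
point linearly. -/
lemma false_of_commutator_lt (hG : G ≤ homeoPlus) (hKne : K.Nonempty)
    (hinv : ∀ g ∈ G, ∀ x ∈ K, g x ∈ K) {c g h : ℝ ≃ₜ ℝ} (hc : c ∈ G) (hg : g ∈ G) (hh : h ∈ G)
    (hlt : ∀ x, x < c x) (hcg : ∀ x ∈ K, c (g x) = g (c x)) (hch : ∀ x ∈ K, c (h x) = h (c x))
    (hgh : ∀ x ∈ K, h (g x) = c (g (h x))) : False := by
  obtain ⟨x, hx⟩ := hKne
  have hcK := hinv c hc
  have hgK := hinv g hg
  have hhK := hinv h hh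
  have hmono : ∀ {k}, k ∈ G → Monotone k := fun hk => (homeoPlus_strictMono (hG hk)).monotone
  have hcpow : ∀ (k l : ℕ) (y : ℝ), (c ^ k) ((c ^ l) y) = (c ^ (k + l)) y := fun k l y => by
    rw [pow_add, Homeomorph.mul_apply]
  have hcle : ∀ {k l : ℕ}, k ≤ l → ∀ y, (c ^ k) y ≤ (c ^ l) y := fun {k l} hkl y => by
    refine monotone_nat_of_le_succ (f := fun k => (c ^ k) y) (fun k => ?_) hkl
    simp only [pow_succ', Homeomorph.mul_apply]
    exact (hlt _).le
  -- upper and lower bounds for the displacement of `x` by the iterates of an element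
  have hup : ∀ {k : ℝ ≃ₜ ℝ}, k ∈ G → (∀ y ∈ K, c (k y) = k (c y)) → ∀ a : ℕ, k x ≤ (c ^ a) x →
      ∀ n : ℕ, (k ^ n) x ≤ (c ^ (a * n)) x := by
    intro k hk hck a ha n
    induction n with
    | zero => exact le_rfl
    | succ n ih =>
      rw [pow_succ', Homeomorph.mul_apply]
      refine (hmono hk ih).trans ?_
      rw [pow_comm_apply hcK (fun y hy => (hck y hy).symm) _ hx]
      refine (hmono (G.pow_mem hc _) ha).trans ?_
      rw [hcpow, mul_add, mul_one]
  have hlow : ∀ {k : ℝ ≃ₜ ℝ}, k ∈ G → (∀ y ∈ K, c (k y) = k (c y)) → ∀ a : ℕ, x ≤ (c ^ a) (k x) →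
      ∀ n : ℕ, x ≤ (c ^ (a * n)) ((k ^ n) x) := by
    intro k hk hck a ha n
    induction n with
    | zero => exact le_rfl
    | succ n ih =>
      have h1 := hmono hk ih
      rw [pow_comm_apply hcK (fun y hy => (hck y hy).symm) _ (pow_apply_mem (hinv k hk) n hx)] at h1
      refine ha.trans ((hmono (G.pow_mem hc _) h1).trans ?_)
      rw [hcpow, pow_succ' k, Homeomorph.mul_apply, mul_add, mul_one, add_comm]
  obtain ⟨a, hga, hha, hga', hha'⟩ : ∃ a : ℕ, g x ≤ (c ^ a) x ∧ h x ≤ (c ^ a) x ∧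
      x ≤ (c ^ a) (g x) ∧ x ≤ (c ^ a) (h x) := by
    obtain ⟨a₁, h₁⟩ := exists_lt_pow_apply hlt x (g x)
    obtain ⟨a₂, h₂⟩ := exists_lt_pow_apply hlt x (h x)
    obtain ⟨a₃, h₃⟩ := exists_lt_pow_apply hlt (g x) x
    obtain ⟨a₄, h₄⟩ := exists_lt_pow_apply hlt (h x) x
    exact ⟨a₁ + a₂ + a₃ + a₄, h₁.le.trans (hcle (by omega) _), h₂.le.trans (hcle (by omega) _),
      h₃.le.trans (hcle (by omega) _), h₄.le.trans (hcle (by omega) _)⟩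
  -- the relation `h ^ n g ^ m = c ^ (n m) g ^ m h ^ n`
  have hrel₁ : ∀ (m : ℕ) {y : ℝ}, y ∈ K → h ((g ^ m) y) = (c ^ m) ((g ^ m) (h y)) := by
    intro m
    induction m with
    | zero => exact fun _ => rfl
    | succ m ih =>
      intro y hy
      have h1 := pow_apply_mem hgK m hy
      rw [pow_succ' g, Homeomorph.mul_apply, hgh _ h1, ih hy,
        pow_comm_apply hcK (fun y hy => (hcg y hy).symm) m (pow_apply_mem hgK m (hhK y hy)),
        pow_succ', Homeomorph.mul_apply, Homeomorph.mul_apply]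
  have hrel : ∀ n m : ℕ, (h ^ n) ((g ^ m) x) = (c ^ (n * m)) ((g ^ m) ((h ^ n) x)) := by
    intro n m
    induction n with
    | zero => rw [zero_mul]; rfl
    | succ n ih =>
      rw [pow_succ' h, Homeomorph.mul_apply, ih, pow_comm_apply hcK
        (fun y hy => (hch y hy).symm) _ (pow_apply_mem hgK m (pow_apply_mem hhK n hx)),
        hrel₁ m (pow_apply_mem hhK n hx), hcpow, Homeomorph.mul_apply]
      congr 2
      ring
  -- the displacement `n ^ 2` exceeds the linear bound `4 * a * n` as soon as `n > 4 * a`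
  set n := 4 * a + 1 with hn
  set y := (g ^ n) ((h ^ n) x) with hy
  have hcgn : ∀ z ∈ K, (g ^ n) (c z) = c ((g ^ n) z) := fun z hz =>
    (pow_comm_apply hgK hcg n hz).symm
  have hchn : ∀ z ∈ K, (h ^ n) (c z) = c ((h ^ n) z) := fun z hz =>
    (pow_comm_apply hhK hch n hz).symm
  have e1 : (c ^ (n * n)) y ≤ (c ^ (2 * a * n)) x := by
    rw [← hrel]
    refine (hmono (G.pow_mem hh n) (hup hg hcg a hga n)).trans ?_
    rw [pow_comm_apply hcK hchn _ hx]
    refine (hmono (G.pow_mem hc _) (hup hh hch a hha n)).trans ?_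
    rw [hcpow]
    exact hcle (by linarith) _
  have e2 : x ≤ (c ^ (2 * a * n)) y := by
    refine (hlow hg hcg a hga' n).trans ?_
    have h1 := hmono (G.pow_mem hg n) (hlow hh hch a hha' n)
    rw [pow_comm_apply hcK hcgn _ (pow_apply_mem hhK n hx)] at h1
    refine (hmono (G.pow_mem hc _) h1).trans ?_
    rw [hcpow]
    exact hcle (by linarith) _
  have e3 : (c ^ (n * n)) y ≤ (c ^ (4 * a * n)) y := by
    refine e1.trans ((hmono (G.pow_mem hc _) e2).trans ?_)
    rw [hcpow]
    exact hcle (by linarith) _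
  have e4 : (c ^ (4 * a * n)) y < (c ^ (4 * a * n + 1)) y := by
    rw [pow_succ', Homeomorph.mul_apply]
    exact hlt _
  exact (e4.trans_le (hcle (by rw [hn]; ring_nf; omega) y)).not_ge e3

/-- A nilpotent group acts on a minimal set through an abelian quotient. -/
lemma IsMinimalClosedInvariant.comm (hG : G ≤ homeoPlus) (hnil : Group.IsNilpotent G)
    (hK : IsMinimalClosedInvariant G K) : ∀ g ∈ G, ∀ h ∈ G, ∀ x ∈ K, g (h x) = h (g x) := by
  classical
  have hinv := hK.prop
  -- `⁅h, g⁆` acts trivially on `K` if and only if `h` and `g` commute on `K`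
  have hcom : ∀ h ∈ G, ∀ g ∈ G, (∀ x ∈ K, ⁅h, g⁆ x = x) → ∀ x ∈ K, h (g x) = g (h x) := by
    intro h hh g hg htriv x hx
    have h1 := htriv _ (hinv.map_mem hg (hinv.map_mem hh hx))
    rwa [commutatorElement_def, Homeomorph.mul_apply, Homeomorph.mul_apply, Homeomorph.mul_apply,
      inv_apply_apply, inv_apply_apply] at h1
  have hex : ∃ j, ∀ z ∈ G.lowerCentralSeries j, ∀ x ∈ K, z x = x := by
    obtain ⟨n, hn⟩ := (Subgroup.isNilpotent_iff_lowerCentralSeries G).mp hnil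
    refine ⟨n, fun z hz x _ => ?_⟩
    rw [hn, Subgroup.mem_bot] at hz
    rw [hz, Homeomorph.one_apply]
  obtain ⟨j, hj, hmin⟩ : ∃ j, (∀ z ∈ G.lowerCentralSeries j, ∀ x ∈ K, z x = x) ∧
      ∀ i < j, ¬ ∀ z ∈ G.lowerCentralSeries i, ∀ x ∈ K, z x = x :=
    ⟨Nat.find hex, Nat.find_spec hex, fun i hi => Nat.find_min hex hi⟩
  match j, hj, hmin with
  | 0, hj, _ =>
    intro g hg h hh x hx
    rw [hj h hh x hx, hj g hg x hx, hj h hh x hx]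
  | 1, hj, _ =>
    exact fun g hg h hh => hcom g hg h hh (hj _ (Subgroup.commutator_mem_commutator hg hh))
  | j + 2, hj, hmin =>
    refine absurd (fun z hz x hx => ?_) (hmin (j + 1) (Nat.lt_succ_self _))
    have hle : G.lowerCentralSeries (j + 1) ≤ G := G.lowerCentralSeries_le_self _
    have hcen : ∀ c ∈ G.lowerCentralSeries (j + 1), ∀ g ∈ G, ∀ x ∈ K, c (g x) = g (c x) :=
      fun c hc g hg => hcom c (hle hc) g hg (hj _ (Subgroup.commutator_mem_commutator hc hg))
    have hgen : ∀ h ∈ G.lowerCentralSeries j, ∀ g ∈ G, ∀ x ∈ K, ⁅h, g⁆ x = x := by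
      intro h hh' g hg
      have hh : h ∈ G := G.lowerCentralSeries_le_self _ hh'
      have hc : ⁅h, g⁆ ∈ G.lowerCentralSeries (j + 1) :=
        Subgroup.commutator_mem_commutator hh' hg
      have hc' : ⁅g, h⁆ ∈ G.lowerCentralSeries (j + 1) := by
        rw [← commutatorElement_inv]; exact Subgroup.inv_mem _ hc
      by_contra! hmoved
      obtain ⟨y, hy, hcy⟩ := hmoved
      have hfree := apply_ne_of_forall_mem hG hinv.1 hinv.2.1 (fun g hg x hx => hinv.map_mem hg hx)
        (hle hc) fun x hx hcx => hcy (hK.eq_of_fixed (hcen _ hc) hx hcx y hy)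
      have hrel : ∀ g h : ℝ ≃ₜ ℝ, ∀ x, h (g x) = ⁅h, g⁆ (g (h x)) := fun g h x => by
        rw [commutatorElement_def, Homeomorph.mul_apply, Homeomorph.mul_apply,
          Homeomorph.mul_apply, inv_apply_apply, inv_apply_apply]
      rcases forall_lt_or_forall_gt hfree with hlt | hlt
      · exact false_of_commutator_lt hG hinv.1 (fun g hg x hx => hinv.map_mem hg hx) (hle hc) hg hh
          hlt (hcen _ hc g hg) (hcen _ hc h hh) fun x _ => hrel g h x
      · refine false_of_commutator_lt hG hinv.1 (fun g hg x hx => hinv.map_mem hg hx) (hle hc') hh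
          hg (fun x => ?_) (hcen _ hc' h hh) (hcen _ hc' g hg) fun x _ => hrel h g x
        have := hlt (⁅g, h⁆ x)
        rwa [← commutatorElement_inv g h, inv_apply_apply] at this
    have hcl : G.lowerCentralSeries (j + 1) ≤ fixator K := Subgroup.commutator_le.mpr hgen
    exact hcl hz x hx

end Minimal

/-! ### Translation numbers and the invariant measure -/

section TranslationNumber

variable {G : Subgroup (ℝ ≃ₜ ℝ)} {K : Set ℝ} {f : ℝ ≃ₜ ℝ}

lemma strictMono_zpow_apply (hlt : ∀ x, x < f x) (x : ℝ) : StrictMono fun n : ℤ => (f ^ n) x :=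
  strictMono_int_of_lt_succ fun n => by
    rw [add_comm, zpow_add, zpow_one, Homeomorph.mul_apply]
    exact hlt _

/-- The orbit of `x₀` under `f` cuts the line into fundamental domains: `N y` is the largest `n`
with `fⁿ x₀ ≤ y`. -/
lemma exists_orbit_floor (hf : f ∈ homeoPlus) (hlt : ∀ x, x < f x) (x₀ : ℝ) :
    ∃ N : ℝ → ℤ, ∀ y, ∀ n : ℤ, n ≤ N y ↔ (f ^ n) x₀ ≤ y := by
  have hm := strictMono_zpow_apply hlt x₀
  have key : ∀ y, ∃ N : ℤ, ∀ n : ℤ, n ≤ N ↔ (f ^ n) x₀ ≤ y := by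
    intro y
    obtain ⟨k, hk⟩ := exists_lt_pow_apply hlt x₀ y
    obtain ⟨l, hl⟩ := exists_lt_pow_apply hlt y x₀
    have hl' : (f ^ (-(l : ℤ))) x₀ ≤ y := by
      have h1 := (homeoPlus_strictMono (homeoPlus.inv_mem (homeoPlus.pow_mem hf l))) hl
      rw [inv_apply_apply] at h1
      rw [zpow_neg, zpow_natCast]
      exact h1.le
    obtain ⟨N, hN, hmax⟩ := Int.exists_greatest_of_bdd (P := fun n => (f ^ n) x₀ ≤ y)
      ⟨k, fun n hn => (hm.lt_iff_lt.mp (hn.trans_lt (by simpa using hk))).le⟩ ⟨_, hl'⟩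
    exact ⟨N, fun n => ⟨fun h => (hm.monotone h).trans hN, hmax n⟩⟩
  choose N hN using key
  exact ⟨N, hN⟩

/-- For a group acting commutatively on an invariant set `K`, the translation numbers with respect
to a fixed point free element `f`, computed along the orbit of `x₀ ∈ K`, form a homomorphism
compatible with the order of the orbit. -/
lemma exists_translationNumber (hG : G ≤ homeoPlus) (hinv : ∀ g ∈ G, ∀ x ∈ K, g x ∈ K)
    (hcomm : ∀ g ∈ G, ∀ h ∈ G, ∀ x ∈ K, g (h x) = h (g x)) (hf : f ∈ G) (hlt : ∀ x, x < f x)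
    {x₀ : ℝ} (hx₀ : x₀ ∈ K) :
    ∃ τ : (ℝ ≃ₜ ℝ) → ℝ, (∀ g ∈ G, ∀ h ∈ G, τ (g * h) = τ g + τ h) ∧
      (∀ g ∈ G, ∀ h ∈ G, g x₀ ≤ h x₀ → τ g ≤ τ h) ∧ τ f = 1 := by
  obtain ⟨N, hN⟩ := exists_orbit_floor (hG hf) hlt x₀
  have hm := strictMono_zpow_apply hlt x₀
  have hNle : ∀ y, (f ^ N y) x₀ ≤ y := fun y => (hN y _).mp le_rfl
  have hNlt : ∀ y, y < (f ^ (N y + 1)) x₀ := fun y => by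
    by_contra! hcon
    have := (hN y _).mpr hcon
    omega
  have hNf : ∀ n : ℤ, N ((f ^ n) x₀) = n := fun n =>
    le_antisymm (hm.le_iff_le.mp (hNle _)) ((hN _ _).mpr le_rfl)
  have hNmono : Monotone N := fun y z hyz => (hN _ _).mpr ((hNle y).trans hyz)
  have hNmul : ∀ g ∈ G, ∀ y, N y + N (g x₀) ≤ N (g y) ∧ N (g y) ≤ N y + N (g x₀) + 1 := by
    intro g hg y
    have hgm := homeoPlus_strictMono (hG hg)
    have hfm : ∀ n : ℤ, StrictMono (f ^ n) := fun n =>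
      homeoPlus_strictMono (hG (G.zpow_mem hf n))
    have hc : ∀ n : ℤ, g ((f ^ n) x₀) = (f ^ n) (g x₀) := fun n =>
      hcomm g hg _ (G.zpow_mem hf n) x₀ hx₀
    constructor
    · rw [hN, zpow_add, Homeomorph.mul_apply]
      exact ((hfm _).monotone (hNle _)).trans ((hc _).symm.trans_le (hgm.monotone (hNle y)))
    · have h1 : (f ^ N (g y)) x₀ < (f ^ (N y + 1 + (N (g x₀) + 1))) x₀ := by
        rw [zpow_add f (N y + 1), Homeomorph.mul_apply]
        refine (hNle _).trans_lt ((hgm (hNlt y)).trans ?_)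
        rw [hc]
        exact hfm _ (hNlt _)
      have := hm.lt_iff_lt.mp h1
      omega
  have hlim : ∀ g ∈ G, ∃ t : ℝ, Filter.Tendsto (fun k : ℕ => (N ((g ^ k) x₀) : ℝ) / k)
      Filter.atTop (nhds t) := by
    intro g hg
    have hsub : Subadditive fun k : ℕ => -(N ((g ^ k) x₀) : ℝ) := by
      intro k l
      have h1 := (hNmul _ (G.pow_mem hg k) ((g ^ l) x₀)).1
      rw [← Homeomorph.mul_apply, ← pow_add] at h1
      have h2 : (N ((g ^ l) x₀) : ℝ) + N ((g ^ k) x₀) ≤ N ((g ^ (k + l)) x₀) := by exact_mod_cast h1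
      linarith
    have hbd : ∀ k : ℕ, N ((g ^ k) x₀) ≤ k * (N (g x₀) + 1) := by
      intro k
      induction k with
      | zero => simpa using (hNf 0).le
      | succ k ih =>
        have h1 := (hNmul g hg ((g ^ k) x₀)).2
        rw [pow_succ', Homeomorph.mul_apply]
        push_cast
        linarith
    have hbdd : BddBelow (Set.range fun k : ℕ => -(N ((g ^ k) x₀) : ℝ) / k) := by
      refine ⟨-|(N (g x₀) : ℝ) + 1|, ?_⟩
      rintro _ ⟨k, rfl⟩
      rcases Nat.eq_zero_or_pos k with rfl | hk
      · simp
      · have hk' : (0 : ℝ) < k := by exact_mod_cast hk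
        have h1 : (N ((g ^ k) x₀) : ℝ) ≤ k * (N (g x₀) + 1) := by exact_mod_cast hbd k
        rw [le_div_iff₀ hk']
        nlinarith [le_abs_self ((N (g x₀) : ℝ) + 1)]
    refine ⟨-hsub.lim, ((hsub.tendsto_lim hbdd).neg).congr fun k => ?_⟩
    rw [neg_div, neg_neg]
  choose! τ hτ using hlim
  refine ⟨τ, fun g hg h hh => ?_, fun g hg h hh hgh => ?_, ?_⟩
  · have hgK := hinv g hg
    have hhK := hinv h hh
    have hpow : ∀ k : ℕ, ((g * h) ^ k) x₀ = (g ^ k) ((h ^ k) x₀) := by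
      intro k
      induction k with
      | zero => rfl
      | succ k ih =>
        rw [pow_succ', Homeomorph.mul_apply, ih, Homeomorph.mul_apply, pow_succ',
          Homeomorph.mul_apply, pow_succ', Homeomorph.mul_apply,
          hcomm h hh _ (G.pow_mem hg k) _ (hinv _ (G.pow_mem hh k) _ hx₀)]
    -- `N` is additive along the orbit up to an error of one, which vanishes in the limit
    have h1 : Filter.Tendsto (fun k : ℕ => (N (((g * h) ^ k) x₀) : ℝ) / k
        - ((N ((g ^ k) x₀) : ℝ) / k + (N ((h ^ k) x₀) : ℝ) / k)) Filter.atTop (nhds 0) := by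
      refine squeeze_zero (fun k => ?_) (fun k => ?_) tendsto_one_div_atTop_nhds_zero_nat
      · have := (hNmul _ (G.pow_mem hg k) ((h ^ k) x₀)).1
        rw [← add_div, ← sub_div, hpow]
        refine div_nonneg ?_ (Nat.cast_nonneg k)
        have h2 : (N ((h ^ k) x₀) : ℝ) + N ((g ^ k) x₀) ≤ N ((g ^ k) ((h ^ k) x₀)) := by
          exact_mod_cast this
        linarith
      · have := (hNmul _ (G.pow_mem hg k) ((h ^ k) x₀)).2
        rw [← add_div, ← sub_div, hpow]
        refine div_le_div_of_nonneg_right ?_ (Nat.cast_nonneg k)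
        have h2 : (N ((g ^ k) ((h ^ k) x₀)) : ℝ) ≤ N ((h ^ k) x₀) + N ((g ^ k) x₀) + 1 := by
          exact_mod_cast this
        linarith
    have h3 := (hτ _ (G.mul_mem hg hh)).sub ((hτ g hg).add (hτ h hh))
    linarith [tendsto_nhds_unique h1 h3]
  · refine le_of_tendsto_of_tendsto' (hτ g hg) (hτ h hh) fun k =>
      div_le_div_of_nonneg_right ?_ (Nat.cast_nonneg k)
    have : (g ^ k) x₀ ≤ (h ^ k) x₀ := by
      induction k with
      | zero => exact le_rfl
      | succ k ih =>
        rw [pow_succ, Homeomorph.mul_apply, pow_succ', Homeomorph.mul_apply]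
        refine ((homeoPlus_strictMono (hG (G.pow_mem hg k))).monotone hgh).trans ?_
        rw [hcomm _ (G.pow_mem hg k) h hh x₀ hx₀]
        exact (homeoPlus_strictMono (hG hh)).monotone ih
    exact_mod_cast hNmono this
  · refine tendsto_nhds_unique (hτ f hf) ((tendsto_const_nhds (x := (1 : ℝ))).congr' ?_)
    filter_upwards [Filter.eventually_gt_atTop 0] with k hk
    have h1 := hNf k
    rw [zpow_natCast] at h1
    rw [h1, Int.cast_natCast, div_self (by exact_mod_cast hk.ne')]

/-- The invariant measure is the Stieltjes measure of `φ y = inf {τ g | y < g x₀}`, which satisfies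
`φ (h y) = φ y + τ h`. -/
lemma exists_isInvariantRadon_of_comm (hG : G ≤ homeoPlus) (hinv : ∀ g ∈ G, ∀ x ∈ K, g x ∈ K)
    (hcomm : ∀ g ∈ G, ∀ h ∈ G, ∀ x ∈ K, g (h x) = h (g x)) (hf : f ∈ G) (hlt : ∀ x, x < f x)
    {x₀ : ℝ} (hx₀ : x₀ ∈ K) : ∃ μ : Measure ℝ, IsInvariantRadon G μ := by
  obtain ⟨τ, hmul, hmono, hτf⟩ := exists_translationNumber hG hinv hcomm hf hlt hx₀
  obtain ⟨N, hN⟩ := exists_orbit_floor (hG hf) hlt x₀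
  set S : ℝ → Set ℝ := fun y => τ '' {g | g ∈ G ∧ y < g x₀} with hS
  have hne : ∀ y, (S y).Nonempty := fun y => by
    obtain ⟨k, hk⟩ := exists_lt_pow_apply hlt x₀ y
    exact ⟨_, _, ⟨G.pow_mem hf k, hk⟩, rfl⟩
  have hbdd : ∀ y, BddBelow (S y) := fun y => by
    refine ⟨τ (f ^ N y), ?_⟩
    rintro _ ⟨g, ⟨hg, hyg⟩, rfl⟩
    exact hmono _ (G.zpow_mem hf _) g hg (((hN y _).mp le_rfl).trans hyg.le)
  have hanti : ∀ {y z}, y ≤ z → S z ⊆ S y := fun hyz =>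
    Set.image_mono fun g hg => ⟨hg.1, hyz.trans_lt hg.2⟩
  have hφmono : Monotone fun y => sInf (S y) := fun y z hyz =>
    csInf_le_csInf (hbdd y) (hne z) (hanti hyz)
  let φ : StieltjesFunction ℝ :=
    { toFun := fun y => sInf (S y)
      mono' := hφmono
      right_continuous' := fun y => by
        refine tendsto_order.mpr ⟨fun t ht => ?_, fun t ht => ?_⟩
        · filter_upwards [self_mem_nhdsWithin] with z hz
          exact ht.trans_le (hφmono hz)
        · obtain ⟨_, ⟨g, ⟨hg, hyg⟩, rfl⟩, hgt⟩ := exists_lt_of_csInf_lt (hne y) ht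
          filter_upwards [mem_nhdsWithin_of_mem_nhds (Iio_mem_nhds hyg)] with z hz
          exact (csInf_le (hbdd z) ⟨g, ⟨hg, hz⟩, rfl⟩).trans_lt hgt }
  have hle : ∀ h ∈ G, ∀ y, φ (h y) ≤ φ y + τ h := by
    intro h hh y
    rw [← sub_le_iff_le_add]
    refine le_csInf (hne y) ?_
    rintro _ ⟨g, ⟨hg, hyg⟩, rfl⟩
    rw [sub_le_iff_le_add, add_comm, ← hmul h hh g hg]
    exact csInf_le (hbdd _) ⟨h * g, ⟨G.mul_mem hh hg, homeoPlus_strictMono (hG hh) hyg⟩, rfl⟩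
  have hτ1 : τ 1 = 0 := by
    have := hmul 1 G.one_mem 1 G.one_mem
    rw [mul_one] at this
    linarith
  have heq : ∀ h ∈ G, ∀ y, φ (h y) = φ y + τ h := by
    intro h hh y
    refine le_antisymm (hle h hh y) ?_
    have h1 := hle _ (G.inv_mem hh) (h y)
    have h2 := hmul _ (G.inv_mem hh) h hh
    rw [inv_mul_cancel, hτ1] at h2
    rw [inv_apply_apply] at h1
    linarith
  refine ⟨φ.measure, fun h0 => ?_, inferInstance, fun g hg => ?_⟩
  · have h1 : φ.measure (Set.Ioc 0 (f 0)) = 1 := by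
      rw [φ.measure_Ioc, heq f hf, hτf, add_sub_cancel_left, ENNReal.ofReal_one]
    rw [h0, Measure.coe_zero, Pi.zero_apply] at h1
    exact zero_ne_one h1
  · refine (Measure.ext_of_Ioc _ _ fun a b _ => ?_).symm
    rw [Measure.map_apply g.continuous.measurable measurableSet_Ioc]
    have hpre : (g : ℝ → ℝ) ⁻¹' Set.Ioc a b = Set.Ioc (g⁻¹ a) (g⁻¹ b) := by
      have hgm := homeoPlus_strictMono (hG hg)
      ext y
      rw [Set.mem_preimage, Set.mem_Ioc, Set.mem_Ioc, ← hgm.lt_iff_lt (a := g⁻¹ a),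
        ← hgm.le_iff_le (b := g⁻¹ b), apply_inv_apply, apply_inv_apply]
    rw [hpre, φ.measure_Ioc, φ.measure_Ioc, heq _ (G.inv_mem hg), heq _ (G.inv_mem hg),
      add_sub_add_right_eq_sub]

end TranslationNumber

/-! ### Existence of the invariant measure and of the minimal set -/

/-- The derivative of a function of class `C^{1 + α}` is locally Hölder of exponent `min α 1`. -/
lemma IsC1plus.contDiff_and_isLocallyHolder {α : ℝ} (hα : 0 < α) {f : ℝ → ℝ} (hf : IsC1plus α f) :
    ContDiff ℝ 1 f ∧ IsLocallyHolder (min α 1) (deriv f) := by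
  obtain ⟨h1, h2⟩ := hf
  rcases le_or_gt α 1 with hα1 | hα1
  · have hk : ⌈α⌉₊ = 1 := by
      rw [Nat.ceil_eq_iff one_ne_zero]
      exact ⟨by simpa using hα, by simpa using hα1⟩
    rw [hk] at h1 h2
    rw [iteratedDeriv_one] at h2
    refine ⟨by simpa using h1, ?_⟩
    rw [min_eq_left hα1]
    simpa using h2
  · have hk : 2 ≤ ⌈α⌉₊ := Nat.lt_ceil.mpr (by simpa using hα1)
    have h3 : ContDiff ℝ 2 f := h1.of_le (by exact_mod_cast hk)
    refine ⟨h3.of_le (by norm_num), fun a b => ?_⟩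
    have h4 : ContDiff ℝ 1 (deriv f) := by
      have : ContDiff ℝ (1 + 1) f := by rw [one_add_one_eq_two]; exact h3
      exact (contDiff_succ_iff_deriv.mp this).2.2
    obtain ⟨C, hC⟩ := isCompact_Icc.exists_bound_of_continuousOn (s := Set.Icc a b)
      (h4.continuous_deriv le_rfl).continuousOn
    refine ⟨C, fun x hx y hy => ?_⟩
    rw [min_eq_right hα1.le, Real.rpow_one]
    have := (convex_Icc a b).norm_image_sub_le_of_norm_deriv_le
      (fun z _ => h4.differentiable one_ne_zero z) hC hy hx
    simpa [Real.norm_eq_abs] using this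

/-- Let `γ` be the last term of the lower central series of `G` without a global fixed point, and
`F` the set of common fixed points of the next term `⁅γ, G⁆`. Then `γ` acts commutatively
on `F`. -/
lemma exists_actsCommutativelyOn {G : Subgroup (ℝ ≃ₜ ℝ)} (hG : G ≤ homeoPlus)
    (hnil : Group.IsNilpotent G) (hfix : ¬ ∃ x, ∀ g ∈ G, g x = x) :
    ∃ A ≤ G, ∃ F : Set ℝ, F.Nonempty ∧ ActsCommutativelyOn A F := by
  classical
  have hex : ∃ j, ∃ x, ∀ z ∈ G.lowerCentralSeries j, z x = x := by
    obtain ⟨n, hn⟩ := (Subgroup.isNilpotent_iff_lowerCentralSeries G).mp hnil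
    refine ⟨n, 0, fun z hz => ?_⟩
    rw [hn, Subgroup.mem_bot] at hz
    rw [hz, Homeomorph.one_apply]
  obtain ⟨j, ⟨x, hx⟩, hmin⟩ : ∃ j, (∃ x, ∀ z ∈ G.lowerCentralSeries j, z x = x) ∧
      ∀ i < j, ¬ ∃ x, ∀ z ∈ G.lowerCentralSeries i, z x = x :=
    ⟨Nat.find hex, Nat.find_spec hex, fun i hi => Nat.find_min hex hi⟩
  match j, hx, hmin with
  | 0, hx, _ => exact absurd ⟨x, hx⟩ hfix
  | j + 1, hx, hmin =>
    have hle : G.lowerCentralSeries j ≤ G := G.lowerCentralSeries_le_self j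
    have hmaps : ∀ a ∈ G, ∀ x, (∀ z ∈ G.lowerCentralSeries (j + 1), z x = x) →
        ∀ z ∈ G.lowerCentralSeries (j + 1), z (a x) = a x := by
      intro a ha x hx z hz
      have h1 := (Subgroup.mem_normalizer_iff.mp
        (G.self_le_normalizer_lowerCentralSeries (j + 1) (G.inv_mem ha)) z).mp hz
      have h2 := congrArg a (hx _ h1)
      rwa [inv_inv, Homeomorph.mul_apply, Homeomorph.mul_apply, apply_inv_apply] at h2
    refine ⟨G.lowerCentralSeries j, hle, {x | ∀ z ∈ G.lowerCentralSeries (j + 1), z x = x},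
      ⟨x, hx⟩, ⟨hle.trans hG, ?_, fun a ha x hx => hmaps a (hle ha) x hx, ?_, ?_⟩⟩
    · have : {x : ℝ | ∀ z ∈ G.lowerCentralSeries (j + 1), z x = x}
          = ⋂ z ∈ G.lowerCentralSeries (j + 1), {x | z x = x} := by
        ext x
        simp
      rw [this]
      exact isClosed_biInter fun z _ => isClosed_eq z.continuous continuous_id
    · intro a ha b hb x hx
      have h1 := hmaps b (hle hb) _ (hmaps a (hle ha) x hx) ⁅a, b⁆
        (Subgroup.commutator_mem_commutator ha (hle hb))
      rwa [commutatorElement_def, Homeomorph.mul_apply, Homeomorph.mul_apply, Homeomorph.mul_apply,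
        inv_apply_apply, inv_apply_apply] at h1
    · intro x _
      by_contra! hcon
      exact hmin j (Nat.lt_succ_self j) ⟨x, hcon⟩

theorem theorem1p4 (α : ℝ) (hα : 0 < α) (G : Subgroup (ℝ ≃ₜ ℝ)) (hG : G ≤ homeoPlus)
    (hnil : Group.IsNilpotent G) (hreg : ∀ g ∈ G, IsC1plus α (g : ℝ → ℝ)) :
    (∃ μ : Measure ℝ, IsInvariantRadon G μ) ∧ (∃ K : Set ℝ, IsMinimalClosedInvariant G K) := by
  by_cases hfix : ∃ x, ∀ g ∈ G, g x = x
  · obtain ⟨x, hx⟩ := hfix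
    refine ⟨⟨Measure.dirac x, Measure.dirac_ne_zero, inferInstance, fun g hg => ?_⟩, {x},
      ⟨Set.singleton_nonempty x, isClosed_singleton, fun g hg => ?_⟩, fun S hS hSx => ?_⟩
    · rw [Measure.map_dirac' g.continuous.measurable, hx g hg]
    · rw [Set.image_singleton, hx g hg]
    · exact (hS.1.subset_singleton_iff.mp hSx).ge
  · obtain ⟨A, hAG, F, hF, hact⟩ := exists_actsCommutativelyOn hG hnil hfix
    obtain ⟨a, ha, hfree⟩ := hact.exists_fixedPointFree hF (β := min α 1)
      (fun a ha => (hreg a (hAG ha)).contDiff_and_isLocallyHolder hα) (lt_min hα one_pos)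
      (min_le_right _ _)
    obtain ⟨f, hf, hlt⟩ : ∃ f ∈ G, ∀ x, x < f x := by
      rcases forall_lt_or_forall_gt (apply_ne_of_forall_mem hact.le_homeoPlus hF hact.isClosed
        hact.mapsTo ha hfree) with h | h
      · exact ⟨a, hAG ha, h⟩
      · refine ⟨a⁻¹, G.inv_mem (hAG ha), fun x => ?_⟩
        have := h (a⁻¹ x)
        rwa [apply_inv_apply] at this
    obtain ⟨K, hK⟩ := exists_isMinimalClosedInvariant hG hf hlt
    obtain ⟨x₀, hx₀⟩ := hK.prop.1
    exact ⟨exists_isInvariantRadon_of_comm hG (fun g hg x hx => hK.prop.map_mem hg hx)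
      (hK.comm hG hnil) hf hlt hx₀, K, hK⟩
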